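/- **Setting.** Let $\mathbb F$ be a field, $V$ a finite-dimensional $\mathbb F$-vector space and $G\subset \mathrm{GL}(V)$ a finite subgroup. Let $\mathbb F[V]$ be the symmetric algebra of $V^*$, with $G$ acting by algebra automorphisms extending $(g\cdot x)(v)=x(g^{-1}v)$ for $x\in V^*$. For $\chi\in\mathrm{Hom}(G,\mathbb F^\bullet)$ let $\mathbb F[V]^{G,\chi}=\{f: g\cdot f=\chi(g)f\ \text{for all } g\in G\}$ (relative invariants of weight $\chi$), and let $\mathbb F[V]^{G,\mathrm{rel}}=\bigcup_\chi \mathbb F[V]^{G,\chi}$. For a commutative cancellative monoid $M$ write $M_{\mathrm{red}}=M/M^\times$ and let $\mathsf q(M)$ be its quotient group. Put $H=(\mathbb F[V]^G\setminus\{0\})_{\mathrm{red}}$, $D=(\mathbb F[V]^{G,\mathrm{rel}}\setminus\{0\})_{\mathrm{red}}$, $E=(\mathbb F[V]\setminus\{0\})_{\mathrm{red}}$, and let $P\subset E$ be the set of classes of irreducible polynomials. $G$ permutes $P$; the set of orbits $P/G$ is identified with a subset of $E$ by sending an orbit $\{p_1,\dots,p_r\}$ (distinct $p_i$) to $p_1\cdots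 p_r$. Let $w\colon D\to \mathrm{Hom}(G,\mathbb F^\bullet)$ be the homomorphism taking the class of a relative invariant to its weight. A pseudoreflection is a non-identity, non-unipotent element of $G$ fixing a hyperplane of $V$ pointwise; $\mathrm{Hom}^0(G,\mathbb F^\bullet)\le \mathrm{Hom}(G,\mathbb F^\bullet)$ is the subgroup of characters having all pseudoreflections in their kernel. A monoid homomorphism $\theta\colon A\to B$ is a *divisor homomorphism* if $\theta(a)\mid\theta(b)$ implies $a\mid b$; it is *cofinal* if every element of $B$ divides some $\theta(a)$; it is a *divisor theory* if it is a divisor homomorphism, $B$ is free abelian, and every basis element of $B$ is the gcd of $\theta(X)$ for some finite nonempty $X\subset A$. Its *class group* is $\mathcal C(\theta)=\mathsf q(B)/\mathsf q(\theta(A))$. A monoid is *factorial* if every non-unit is a finite product of prime elements. **Theorem.** 1. The embeddings $\mathbb F[V]^G\setminus\{0\}\overset{\varphi}{\hookrightarrow}\mathbb F[V]^{G,\mathrm{rel}}\setminus\{0\}\overset{\psi}{\hookrightarrow}\mathbb F[V]\setminus\{0\}$ are cofinal divisor homomorphisms. 2. The induced maps $H\to D\to E$ are injective (so $H\subset D\subset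 E$), $D$ is factorial, its set of prime elements is $P/G\subset E$, and $\mathcal C(\varphi)$ is a torsion group. 3. The set $D_0=\{\gcd_D(X): X\subset H \text{ finite, nonempty}\}$ is a submonoid of $D$ and is free abelian with basis $\{q^{e(q)}: q\in P/G\}$ (these elements being pairwise distinct), where $e(q)=\min\{\mathsf v_q(h): h\in H,\ q\mid_D h\}$ and $\mathsf v_q(h)$ is the exponent of $q$ in $h\in D$. The embedding $H\hookrightarrow D_0$ is a divisor theory. 4. $D_0=\{f\in D: w(f)\in \mathrm{Hom}^0(G,\mathbb F^\bullet)\}$, and $w$ induces an isomorphism $\mathcal C(\mathbb F[V]^G)=\mathsf q(D_0)/\mathsf q(H)\to\mathrm{Hom}^0(G,\mathbb F^\bullet)$. **Corollary (Benson–Nakajima).** The divisor class group of $\mathbb F[V]^G$ is isomorphic to $\mathrm{Hom}^0(G,\mathbb F^\bullet)$: for every divisor theory $\theta$ of $H$, $\mathcal C(\theta)\cong \mathrm{Hom}^0(G,\mathbb F^\bullet)$. -/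

import Mathlib

noncomputable section

namespace InvariantDivisors

/-! ### Commutative monoids: primes, greatest common divisors, free bases, class groups -/

section Monoids

universe u v

variable {M : Type u} {N : Type v} [CommMonoid M] [CommMonoid N]

/-- Prime elements of a commutative monoid (without zero). -/
def IsPrimeElement (p : M) : Prop :=
  ¬ IsUnit p ∧ ∀ a b : M, p ∣ a * b → p ∣ a ∨ p ∣ b

/-- A monoid is factorial if every non-invertible element is a finite product of primes. -/
def IsFactorialMonoid (M : Type u) [CommMonoid M] : Prop :=
  ∀ a : M, ¬ IsUnit a → ∃ s : Multiset M, (∀ p ∈ s, IsPrimeElement p) ∧ s.prod = a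

/-- `d` is a greatest common divisor in `M` of the set `X`. -/
def IsGcdOf (X : Set M) (d : M) : Prop :=
  (∀ x ∈ X, d ∣ x) ∧ ∀ c : M, (∀ x ∈ X, c ∣ x) → c ∣ d

/-- The submonoid `S` is free abelian with basis `B`: the map sending a finitely supported
exponent vector `n` to `∏ b ^ n b` is a bijection onto `S`. -/
def IsFreeAbelianWithBasis (S : Submonoid M) (B : Set M) : Prop :=
  Function.Injective (fun n : B →₀ ℕ => n.prod fun b k => (b : M) ^ k) ∧
    Set.range (fun n : B →₀ ℕ => n.prod fun b k => (b : M) ^ k) = (S : Set M)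

/-- Divisor homomorphisms. -/
def IsDivisorHom (f : M →* N) : Prop :=
  ∀ a b : M, f a ∣ f b → a ∣ b

/-- Cofinal homomorphisms. -/
def IsCofinalHom (f : M →* N) : Prop :=
  ∀ α : N, ∃ a : M, α ∣ f a

/-- Divisor theories: divisor homomorphisms into a free abelian monoid all of whose
basis elements are greatest common divisors of finitely many images. -/
def IsDivisorTheory (f : M →* N) : Prop :=
  IsDivisorHom f ∧ ∃ P : Set N, IsFreeAbelianWithBasis (⊤ : Submonoid N) P ∧
    ∀ p ∈ P, ∃ X : Set M, X.Finite ∧ X.Nonempty ∧ IsGcdOf (f '' X) p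

/-- The class group of a homomorphism `f : M → N`: the quotient group of `N` modulo the
subgroup generated by `f(M)`. -/
abbrev HomClassGroup (f : M →* N) : Type v :=
  Algebra.GrothendieckGroup N ⧸
    Subgroup.closure (Set.range fun a : M => Algebra.GrothendieckGroup.of (f a))

/-- The class of an element of `N` in the class group of `f : M → N`. -/
def homClass (f : M →* N) (a : N) : HomClassGroup f :=
  QuotientGroup.mk (Algebra.GrothendieckGroup.of a)

/-- The homomorphism of associated reduced monoids induced by a homomorphism. -/
def redMap (f : M →* N) : Associates M →* Associates N where
  toFun := Quotient.map' f fun _ _ h => h.map f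
  map_one' := congrArg Associates.mk (map_one f)
  map_mul' := by
    rintro ⟨a⟩ ⟨b⟩
    exact congrArg Associates.mk (map_mul f a b)

end Monoids

/-! ### Polynomials on `V` and the action of `GL(V)` -/

section Invariants

universe u v

variable (F : Type u) [Field F] (V : Type v) [AddCommGroup V] [Module F V]

/-- `F[V]`, the symmetric algebra of the dual space of `V`. -/
abbrev Poly : Type (max u v) := SymmetricAlgebra F (Module.Dual F V)

/-- The action of `GL(V)` on `F[V]` by algebra endomorphisms, determined by
`(g · x)(v) = x (g⁻¹ v)` for linear forms `x`. -/
def act : LinearMap.GeneralLinearGroup F V →* (Poly F V →ₐ[F] Poly F V) where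
  toFun g := SymmetricAlgebra.lift
    (SymmetricAlgebra.ι F (Module.Dual F V) ∘ₗ
      LinearMap.dualMap ((g⁻¹ : LinearMap.GeneralLinearGroup F V) : V →ₗ[F] V))
  map_one' := by
    apply SymmetricAlgebra.algHom_ext
    refine LinearMap.ext fun x => ?_
    change SymmetricAlgebra.lift _ (SymmetricAlgebra.ι F _ x) = SymmetricAlgebra.ι F _ x
    rw [SymmetricAlgebra.lift_ι_apply, inv_one]
    rfl
  map_mul' g h := by
    apply SymmetricAlgebra.algHom_ext
    refine LinearMap.ext fun x => ?_
    change SymmetricAlgebra.lift _ (SymmetricAlgebra.ι F _ x) =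
      SymmetricAlgebra.lift _ (SymmetricAlgebra.lift _ (SymmetricAlgebra.ι F _ x))
    rw [SymmetricAlgebra.lift_ι_apply, SymmetricAlgebra.lift_ι_apply, LinearMap.comp_apply,
      LinearMap.comp_apply, SymmetricAlgebra.lift_ι_apply, mul_inv_rev]
    rfl

variable {F V}

theorem act_ne_zero (g : LinearMap.GeneralLinearGroup F V) {f : Poly F V} (hf : f ≠ 0) :
    act F V g f ≠ 0 := by
  intro h
  apply hf
  have h1 : act F V g⁻¹ (act F V g f) = f := by
    rw [← AlgHom.mul_apply, ← map_mul, inv_mul_cancel, map_one, AlgHom.one_apply]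
  rw [← h1, h, map_zero]

variable (G : Subgroup (LinearMap.GeneralLinearGroup F V))

/-- The ring of invariants `F[V]^G`. -/
def invariants : Subalgebra F (Poly F V) where
  carrier := {f | ∀ g ∈ G, act F V g f = f}
  mul_mem' ha hb g hg := by rw [map_mul, ha g hg, hb g hg]
  add_mem' ha hb g hg := by rw [map_add, ha g hg, hb g hg]
  algebraMap_mem' r g _ := AlgHom.commutes _ r

/-- The space of relative invariants of weight `χ`. -/
def relInvariants (χ : G →* Fˣ) : Submodule F (Poly F V) where
  carrier := {f | ∀ g : G, act F V g f = (χ g : F) • f}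
  add_mem' ha hb g := by rw [map_add, ha g, hb g, smul_add]
  zero_mem' g := by rw [map_zero, smul_zero]
  smul_mem' c f hf g := by rw [map_smul, hf g, smul_comm]

variable (F V) in
/-- The monoid of nonzero polynomials. -/
def polyMonoid : Submonoid (Poly F V) where
  carrier := {f | f ≠ 0}
  one_mem' := one_ne_zero
  mul_mem' ha hb := mul_ne_zero ha hb

/-- The monoid of nonzero relative invariants. -/
def relMonoid : Submonoid (Poly F V) where
  carrier := {f | (∃ χ : G →* Fˣ, f ∈ relInvariants G χ) ∧ f ≠ 0}
  one_mem' := ⟨⟨1, fun g => by simp⟩, one_ne_zero⟩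
  mul_mem' := by
    rintro a b ⟨⟨χ, ha⟩, ha0⟩ ⟨⟨η, hb⟩, hb0⟩
    refine ⟨⟨χ * η, fun g => ?_⟩, mul_ne_zero ha0 hb0⟩
    rw [map_mul, ha g, hb g, smul_mul_smul_comm, MonoidHom.mul_apply, Units.val_mul]

/-- The monoid of nonzero invariants. -/
def invMonoid : Submonoid (Poly F V) where
  carrier := {f | f ∈ invariants G ∧ f ≠ 0}
  one_mem' := ⟨one_mem _, one_ne_zero⟩
  mul_mem' ha hb := ⟨mul_mem ha.1 hb.1, mul_ne_zero ha.2 hb.2⟩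

theorem invMonoid_le : invMonoid G ≤ relMonoid G := fun f hf =>
  ⟨⟨1, fun g => by rw [hf.1 g g.2]; simp⟩, hf.2⟩

theorem relMonoid_le : relMonoid G ≤ polyMonoid F V := fun _ hf => hf.2

/-- The embedding of the nonzero invariants into the nonzero relative invariants. -/
def embInvRel : invMonoid G →* relMonoid G := Submonoid.inclusion (invMonoid_le G)

/-- The embedding of the nonzero relative invariants into the nonzero polynomials. -/
def embRelPoly : relMonoid G →* polyMonoid F V := Submonoid.inclusion (relMonoid_le G)

/-- The reduced monoid `H` of nonzero invariants. -/
abbrev RedInv : Type (max u v) := Associates (invMonoid G)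

/-- The reduced monoid `D` of nonzero relative invariants. -/
abbrev RedRel : Type (max u v) := Associates (relMonoid G)

variable (F V) in
/-- The reduced monoid `E` of nonzero polynomials. -/
abbrev RedPoly : Type (max u v) := Associates (polyMonoid F V)

/-- The embedding `H → D`. -/
def redInvRel : RedInv G →* RedRel G := redMap (embInvRel G)

/-- The embedding `D → E`. -/
def redRelPoly : RedRel G →* RedPoly F V := redMap (embRelPoly G)

/-! ### Orbit products -/

/-- The action of `g` on nonzero polynomials. -/
def actNonzero (g : LinearMap.GeneralLinearGroup F V) : polyMonoid F V →* polyMonoid F V where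
  toFun f := ⟨act F V g f, act_ne_zero g f.2⟩
  map_one' := Subtype.ext (map_one _)
  map_mul' _ _ := Subtype.ext (map_mul _ _ _)

variable (F V) in
/-- The set `P` of classes of irreducible polynomials. -/
def irreducibleClasses : Set (RedPoly F V) :=
  {p | ∃ f : polyMonoid F V, Irreducible (f : Poly F V) ∧ p = Associates.mk f}

/-- The `G`-orbit of an element of `E`. -/
def orbit (p : RedPoly F V) : Set (RedPoly F V) :=
  {r | ∃ g ∈ G, r = redMap (actNonzero g) p}

/-- The set `P/G`, each orbit being identified with the product of its distinct elements. -/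
def orbitProducts : Set (RedPoly F V) :=
  {q | ∃ p ∈ irreducibleClasses F V, q = ∏ᶠ r ∈ orbit G p, r}

/-! ### The monoid of greatest common divisors -/

/-- The elements of `D` which are the gcd in `D` of a finite set of elements of `H`. -/
def gcdSet : Set (RedRel G) :=
  {d | ∃ X : Set (RedInv G), X.Finite ∧ X.Nonempty ∧ IsGcdOf (redInvRel G '' X) d}

/-- The submonoid `D₀` of `D` generated by the greatest common divisors in `D` of finite
sets of elements of `H`. -/
def gcdMonoid : Submonoid (RedRel G) := Submonoid.closure (gcdSet G)

theorem redInvRel_mem (h : RedInv G) : redInvRel G h ∈ gcdMonoid G :=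
  Submonoid.subset_closure ⟨{h}, Set.finite_singleton h, Set.singleton_nonempty h, by
    constructor
    · rintro _ ⟨x, rfl, rfl⟩
      exact dvd_rfl
    · intro c hc
      exact hc _ ⟨h, rfl, rfl⟩⟩

/-- The embedding `H → D₀`. -/
def redInvGcd : RedInv G →* gcdMonoid G := (redInvRel G).codRestrict (gcdMonoid G) (redInvRel_mem G)

/-- The minimum of the exponents of `q` in those elements of `H` that `q` divides in `D`. -/
def ramIndex (q : RedRel G) : ℕ :=
  sInf {k : ℕ | ∃ h : RedInv G, q ∣ redInvRel G h ∧ emultiplicity q (redInvRel G h) = k}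

/-! ### Weights -/

/-- A unit of `F[V]` is fixed by the action. -/
theorem act_of_isUnit (g : LinearMap.GeneralLinearGroup F V) {f : Poly F V} (hf : IsUnit f) :
    act F V g f = f := by
  let b := Module.Free.chooseBasis F (Module.Dual F V)
  let e := SymmetricAlgebra.equivMvPolynomial b
  obtain ⟨r, -, hr⟩ := MvPolynomial.isUnit_iff_eq_C_of_isReduced.1 (hf.map e)
  have h : f = algebraMap F (Poly F V) r := by
    apply e.injective
    rw [hr, AlgEquiv.commutes, MvPolynomial.algebraMap_eq]
  rw [h, AlgHom.commutes]

theorem weight_unique {χ η : G →* Fˣ} {f : Poly F V} (hf : f ≠ 0)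
    (h1 : f ∈ relInvariants G χ) (h2 : f ∈ relInvariants G η) : χ = η := by
  ext g
  have h : (χ g : F) • f = (η g : F) • f := (h1 g).symm.trans (h2 g)
  exact smul_left_injective F hf h

/-- The weight of a nonzero relative invariant. -/
def relWeight : relMonoid G →* (G →* Fˣ) where
  toFun f := f.2.1.choose
  map_one' := weight_unique G one_ne_zero (1 : relMonoid G).2.1.choose_spec
    (fun g => by simp)
  map_mul' a b := weight_unique G (a * b).2.2 (a * b).2.1.choose_spec (fun g => by
    have ha := a.2.1.choose_spec g
    have hb := b.2.1.choose_spec g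
    rw [Submonoid.coe_mul, map_mul, ha, hb, smul_mul_smul_comm, MonoidHom.mul_apply,
      Units.val_mul])

theorem relWeight_spec (f : relMonoid G) : (f : Poly F V) ∈ relInvariants G (relWeight G f) :=
  f.2.1.choose_spec

theorem relWeight_unit (u : (relMonoid G)ˣ) : relWeight G u = 1 := by
  refine weight_unique G (u : relMonoid G).2.2 (relWeight_spec G u) (fun g => ?_)
  have h : IsUnit ((u : relMonoid G) : Poly F V) := u.isUnit.map (relMonoid G).subtype
  rw [act_of_isUnit _ h]
  simp

/-- The weight homomorphism `w : D → Hom(G, Fˣ)`. -/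
def weight : RedRel G →* (G →* Fˣ) where
  toFun := Quotient.lift (relWeight G) (by
    rintro a _ ⟨u, rfl⟩
    exact ((map_mul (relWeight G) a u).trans
      ((congrArg (relWeight G a * ·) (relWeight_unit G u)).trans
        (mul_one (relWeight G a)))).symm)
  map_one' := map_one (relWeight G)
  map_mul' := by
    rintro ⟨a⟩ ⟨b⟩
    exact map_mul (relWeight G) a b

/-- Pseudoreflections: non-identity, non-unipotent elements of `GL(V)` fixing a hyperplane
pointwise. -/
def IsPseudoreflection (g : LinearMap.GeneralLinearGroup F V) : Prop :=
  g ≠ 1 ∧ (∃ W : Submodule F V, IsCoatom W ∧ ∀ v ∈ W, (g : V →ₗ[F] V) v = v) ∧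
    ¬ IsNilpotent ((g : Module.End F V) - 1)

/-- `Hom⁰(G, Fˣ)`: the characters with all pseudoreflections of `G` in their kernel. -/
def homZero : Subgroup (G →* Fˣ) where
  carrier := {χ | ∀ g : G, IsPseudoreflection (g : LinearMap.GeneralLinearGroup F V) → χ g = 1}
  one_mem' _ _ := rfl
  mul_mem' ha hb g hg := by rw [MonoidHom.mul_apply, ha g hg, hb g hg, one_mul]
  inv_mem' ha g hg := by rw [MonoidHom.inv_apply, ha g hg, inv_one]

end Invariants

end InvariantDivisors

end

open InvariantDivisors

/-!
Relative invariants on `V` form a monoid whose reduced quotient `D` consists, inside the free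
abelian monoid `E` of polynomials up to constants, of the elements fixed by `G`
(`exists_redRelPoly_eq`). As `G` permutes the irreducible classes, the orbit products are the primes
of `D`, and the orbit product of `p` divides a relative invariant exactly if `p` does
(`exists_orbitProduct`). Inside `D`, the invariants are the kernel of the weight.

Everything else depends on one equality: the greatest common divisors `D₀` of invariants are the
elements of `D` whose weight is trivial on pseudoreflections (`mem_gcdSet_iff`).

* A pseudoreflection `g` acts trivially modulo the linear form `p` of its hyperplane, so the weight
  of a relative invariant prime to `p` is trivial on `g` (`eq_one_of_not_dvd`). If `d` is the gcd of
  a set of invariants, one of them has a cofactor of `d` that is prime to `p`; as invariants have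
  weight one, the weight of `d` is trivial on `g`.
* Conversely, let `χ` be trivial on pseudoreflections. For every prime `p` there is a relative
  invariant of weight `χ` not divisible by `p` (`exists_relInvariant_not_dvd`), and multiplying `d`
  by such relative invariants of the weight inverse to that of `d` gives invariants with gcd `d`.
  For their existence, `χ` is shown to be trivial on the inertia group of `p`: a nontrivial element
  fixes a hyperplane with equation `p` and is either a pseudoreflection or fixes `p`, in which case
  all weights are trivial on it (`eq_one_of_act_eq`). Linear independence of homomorphisms, applied
  to twisted sums over the cosets of the inertia group, then gives the relative invariant in all
  characteristics (`exists_relInvariant_notMem`).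

Consequently `D₀` is closed under exact division in `D`. The power `q ^ e(q)` lies in `D₀` and
divides every element of `D₀` that `q` divides, so these powers form a basis
(`isFreeAbelianWithBasis_gcdMonoid`). The weight maps `D₀` onto `Hom⁰(G, Fˣ)` with kernel the
invariants, which computes the class group (`exists_homClassGroup_equiv`). An arbitrary divisor
theory of `H` is isomorphic to `H → D₀`, because the multiples in `H` of a gcd of elements of `H`
are determined by divisibility in `H` (`IsDivisorTheory.dvd_iff`, `IsDivisorTheory.exists_equiv`).
-/

open scoped Pointwise

namespace InvariantDivisors

/-! ### Reduced monoids, divisor homomorphisms and class groups -/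

section Monoids

variable {M N A : Type*} [CommMonoid M] [CommMonoid N] [CommGroup A]

instance isCancelMulAssociates [IsCancelMul M] : IsCancelMul (Associates M) :=
  have : IsLeftCancelMul (Associates M) := ⟨by
    rintro ⟨a⟩ ⟨b⟩ ⟨c⟩ h
    obtain ⟨u, hu⟩ := Associates.mk_eq_mk_iff_associated.1 h
    refine Associates.mk_eq_mk_iff_associated.2 ⟨u, mul_left_cancel (a := a) ?_⟩
    exact (mul_assoc a b u).symm.trans hu⟩
  CommMagma.IsLeftCancelMul.toIsCancelMul _

theorem associated_of_mutual_dvd [IsCancelMul M] {a b : M} (h : a ∣ b) (h' : b ∣ a) :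
    Associated a b := by
  obtain ⟨c, rfl⟩ := h
  obtain ⟨d, hd⟩ := h'
  have hcd : c * d = 1 := mul_left_cancel (a := a) (by rw [← mul_assoc, ← hd, mul_one])
  exact ⟨Units.mkOfMulEqOne c d hcd, rfl⟩

theorem associates_antisymm [IsCancelMul M] {a b : Associates M} (h : a ∣ b) (h' : b ∣ a) :
    a = b := by
  obtain ⟨a, rfl⟩ := Associates.mk_surjective a
  obtain ⟨b, rfl⟩ := Associates.mk_surjective b
  exact Associates.mk_eq_mk_iff_associated.2
    (associated_of_mutual_dvd (Associates.mk_dvd_mk.1 h) (Associates.mk_dvd_mk.1 h'))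

@[simp] theorem redMap_mk (f : M →* N) (a : M) :
    redMap f (Associates.mk a) = Associates.mk (f a) := rfl

theorem IsDivisorHom.redMap {f : M →* N} (hf : IsDivisorHom f) : IsDivisorHom (redMap f) := by
  intro a b h
  obtain ⟨a, rfl⟩ := Associates.mk_surjective a
  obtain ⟨b, rfl⟩ := Associates.mk_surjective b
  exact Associates.mk_dvd_mk.2 (hf a b (Associates.mk_dvd_mk.1 h))

theorem IsCofinalHom.redMap {f : M →* N} (hf : IsCofinalHom f) : IsCofinalHom (redMap f) := by
  intro a
  obtain ⟨a, rfl⟩ := Associates.mk_surjective a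
  obtain ⟨b, hb⟩ := hf a
  exact ⟨Associates.mk b, Associates.mk_dvd_mk.2 hb⟩

theorem IsDivisorHom.redMap_injective [IsCancelMul M] {f : M →* N} (hf : IsDivisorHom f) :
    Function.Injective (InvariantDivisors.redMap f) := fun a b h =>
  associates_antisymm (hf.redMap a b (dvd_of_eq h)) (hf.redMap b a (dvd_of_eq h.symm))

/-- The class group of a cofinal homomorphism `f` whose image is the kernel of a surjection `w`
onto a group is isomorphic to that group: a fraction `a / b` killed by `w` can be extended to a
fraction with denominator, and hence also numerator, in the image of `f`. -/
theorem exists_homClassGroup_equiv {f : M →* N} {w : N →* A} (hf : IsCofinalHom f)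
    (hker : ∀ n, w n = 1 ↔ n ∈ Set.range f) (hw : Function.Surjective w) :
    ∃ e : HomClassGroup f ≃* A, ∀ n, e (homClass f n) = w n := by
  set W := Algebra.GrothendieckGroup.lift w with hW
  have hWof : ∀ n, W (Algebra.GrothendieckGroup.of n) = w n := fun n =>
    DFunLike.congr_fun (Algebra.GrothendieckGroup.lift.symm_apply_apply w) n
  have hmk : ∀ x : Algebra.GrothendieckGroup N, ∃ a b : N,
      x = Algebra.GrothendieckGroup.of a / Algebra.GrothendieckGroup.of b := by
    intro x
    obtain ⟨⟨a, b⟩, h⟩ := (Localization.monoidOf (⊤ : Submonoid N)).surj x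
    exact ⟨a, b, eq_div_of_mul_eq' h⟩
  set K := Subgroup.closure (Set.range fun a : M => Algebra.GrothendieckGroup.of (f a))
  have hK : ∀ a, Algebra.GrothendieckGroup.of (f a) ∈ K := fun a =>
    Subgroup.subset_closure ⟨a, rfl⟩
  have hKW : K = W.ker := by
    apply le_antisymm
    · rw [Subgroup.closure_le]
      rintro _ ⟨a, rfl⟩
      exact (hWof _).trans ((hker _).2 ⟨a, rfl⟩)
    · intro x hx
      obtain ⟨a, b, rfl⟩ := hmk x
      rw [MonoidHom.mem_ker, map_div, hWof, hWof, div_eq_one] at hx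
      obtain ⟨h, y, hy⟩ := hf b
      have h1 : w (a * y) = 1 := by
        rw [map_mul, hx, ← map_mul, ← hy]
        exact (hker _).2 ⟨h, rfl⟩
      obtain ⟨k, hk⟩ := (hker _).1 h1
      have : Algebra.GrothendieckGroup.of a / Algebra.GrothendieckGroup.of b =
          Algebra.GrothendieckGroup.of (f k) / Algebra.GrothendieckGroup.of (f h) := by
        rw [hk, hy, map_mul, map_mul, mul_div_mul_right_eq_div]
      rw [this]
      exact K.div_mem (hK _) (hK _)
  have hWs : Function.Surjective W := fun x => by
    obtain ⟨n, rfl⟩ := hw x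
    exact ⟨_, hWof n⟩
  refine ⟨(QuotientGroup.quotientMulEquivOfEq hKW).trans
    (QuotientGroup.quotientKerEquivOfSurjective W hWs), fun n => ?_⟩
  exact hWof n

theorem isMulTorsion_homClassGroup {f : M →* N} {n : ℕ} (hn : 0 < n)
    (h : ∀ a : N, a ^ n ∈ Set.range f) : IsMulTorsion (HomClassGroup f) := by
  intro x
  obtain ⟨x, rfl⟩ := QuotientGroup.mk_surjective x
  obtain ⟨⟨a, b⟩, hx⟩ := (Localization.monoidOf (⊤ : Submonoid N)).surj x
  rw [isOfFinOrder_iff_pow_eq_one]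
  refine ⟨n, hn, ?_⟩
  rw [← QuotientGroup.mk_pow, QuotientGroup.eq_one_iff]
  have hx' : x = Algebra.GrothendieckGroup.of a / Algebra.GrothendieckGroup.of (b : N) :=
    eq_div_of_mul_eq' hx
  have hmem : ∀ c : N, Algebra.GrothendieckGroup.of c ^ n ∈
      Subgroup.closure (Set.range fun a : M => Algebra.GrothendieckGroup.of (f a)) := fun c => by
    obtain ⟨m, hm⟩ := h c
    rw [← map_pow, ← hm]
    exact Subgroup.subset_closure ⟨m, rfl⟩
  rw [hx', div_pow]
  exact Subgroup.div_mem _ (hmem _) (hmem _)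

/-- Products of distinct primes: in a cancellative monoid, finitely many primes none of which
divides another one divide an element together as soon as each of them does. -/
theorem prod_dvd_of_isPrimeElement [IsCancelMul M] (s : Finset M)
    (hs : ∀ p ∈ s, IsPrimeElement p) (hne : ∀ p ∈ s, ∀ q ∈ s, p ∣ q → p = q) {x : M}
    (hx : ∀ p ∈ s, p ∣ x) : ∏ p ∈ s, p ∣ x := by
  classical
  induction s using Finset.induction_on with
  | empty => simp
  | insert a s ha ih =>
    obtain ⟨y, rfl⟩ := ih (fun p hp => hs p (Finset.mem_insert_of_mem hp))
      (fun p hp q hq => hne p (Finset.mem_insert_of_mem hp) q (Finset.mem_insert_of_mem hq))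
      (fun p hp => hx p (Finset.mem_insert_of_mem hp))
    have hap := hs a (Finset.mem_insert_self _ _)
    -- `a` does not divide the product of the others, hence divides the cofactor `y`
    have hnd : ∀ t ⊆ s, ¬ a ∣ ∏ p ∈ t, p := by
      intro t
      induction t using Finset.induction_on with
      | empty => intro _ h; exact hap.1 (isUnit_of_dvd_one (by simpa using h))
      | insert b t hb iht =>
        intro hts h
        rw [Finset.prod_insert hb] at h
        rcases hap.2 _ _ h with h | h
        · have := hne a (Finset.mem_insert_self _ _) b
            (Finset.mem_insert_of_mem (hts (Finset.mem_insert_self _ _))) h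
          exact ha (this ▸ hts (Finset.mem_insert_self _ _))
        · exact iht (fun q hq => hts (Finset.mem_insert_of_mem hq)) h
    rw [Finset.prod_insert ha, mul_comm]
    exact mul_dvd_mul_left _
      ((hap.2 _ _ (hx a (Finset.mem_insert_self _ _))).resolve_left (hnd s subset_rfl))

theorem IsPrimeElement.dvd_of_dvd_pow {p : M} (hp : IsPrimeElement p) {a : M} {n : ℕ}
    (h : p ∣ a ^ n) : p ∣ a := by
  induction n with
  | zero => exact absurd (isUnit_of_dvd_one (by simpa using h)) hp.1
  | succ n ih =>
    rw [pow_succ] at h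
    exact (hp.2 _ _ h).elim ih id

theorem IsPrimeElement.exists_dvd_of_dvd_finsuppProd {B : Set M} {p : M}
    (hp : IsPrimeElement p) {n : B →₀ ℕ} (h : p ∣ n.prod fun b k => (b : M) ^ k) :
    ∃ b, n b ≠ 0 ∧ p ∣ b := by
  classical
  have key : ∀ t : Finset B, p ∣ ∏ b ∈ t, (b : M) ^ n b → ∃ b ∈ t, p ∣ b := by
    intro t
    induction t using Finset.induction_on with
    | empty => intro h; exact absurd (isUnit_of_dvd_one (by simpa using h)) hp.1
    | insert b t hb ih =>
      intro h
      rw [Finset.prod_insert hb] at h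
      rcases hp.2 _ _ h with h | h
      · exact ⟨b, Finset.mem_insert_self _ _, hp.dvd_of_dvd_pow h⟩
      · obtain ⟨c, hc, hc'⟩ := ih h
        exact ⟨c, Finset.mem_insert_of_mem hc, hc'⟩
  obtain ⟨b, hb, hpb⟩ := key _ h
  exact ⟨b, Finsupp.mem_support_iff.1 hb, hpb⟩

theorem finsuppProd_single_add {B : Set M} (b : B) (n : B →₀ ℕ) :
    ((Finsupp.single b 1 + n).prod fun b k => (b : M) ^ k) =
      b * n.prod fun b k => (b : M) ^ k := by
  classical
  rw [Finsupp.prod_add_index' (by simp) (fun _ _ _ => pow_add _ _ _),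
    Finsupp.prod_single_index (by simp), pow_one]

/-- Elements of `B` are multiplicatively independent if each of them has a prime divisor that
divides no other element of `B`. -/
theorem injective_finsuppProd_of_isPrimeElement [IsCancelMul M] {B : Set M}
    (hB : ∀ b ∈ B, ∃ p, IsPrimeElement p ∧ p ∣ b ∧ ∀ c ∈ B, p ∣ c → c = b) :
    Function.Injective (fun n : B →₀ ℕ => n.prod fun b k => (b : M) ^ k) := by
  classical
  have hle : ∀ (b : B) (n : B →₀ ℕ), n b ≠ 0 → ∃ m, n = Finsupp.single b 1 + m := fun b n h =>
    ⟨n - Finsupp.single b 1, (add_tsub_cancel_of_le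
      (Finsupp.single_le_iff.2 (Nat.one_le_iff_ne_zero.2 h))).symm⟩
  intro n m h
  dsimp only at h
  induction hk : n.degree generalizing n m with
  | zero =>
    rw [Finsupp.degree_eq_zero_iff] at hk
    subst hk
    ext b
    by_contra hb
    obtain ⟨m, rfl⟩ := hle b m (fun h0 => hb (by simp [h0]))
    obtain ⟨p, hp, hpb, -⟩ := hB b b.2
    rw [Finsupp.prod_zero_index, finsuppProd_single_add] at h
    exact hp.1 (isUnit_of_dvd_one (h ▸ hpb.mul_right _))
  | succ k ih =>
    obtain ⟨b, hb⟩ : ∃ b, n b ≠ 0 := by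
      by_contra! h0
      rw [show n = 0 from Finsupp.ext h0] at hk
      simp at hk
    obtain ⟨n, rfl⟩ := hle b n hb
    obtain ⟨p, hp, hpb, hpB⟩ := hB b b.2
    have h1 := h
    rw [finsuppProd_single_add] at h1
    obtain ⟨c, hc, hpc⟩ := hp.exists_dvd_of_dvd_finsuppProd (h1 ▸ hpb.mul_right _)
    obtain rfl : c = b := Subtype.ext (hpB c c.2 hpc)
    obtain ⟨m, rfl⟩ := hle c m hc
    rw [finsuppProd_single_add, finsuppProd_single_add] at h
    rw [ih (mul_left_cancel h) (by rw [map_add, Finsupp.degree_single] at hk; omega)]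

/-- A free basis of a submonoid is also one of the submonoid regarded as a monoid. -/
theorem IsFreeAbelianWithBasis.subtype {S : Submonoid M} {B : Set M}
    (h : IsFreeAbelianWithBasis S B) (hB : B ⊆ S) :
    IsFreeAbelianWithBasis (⊤ : Submonoid S) {b | (b : M) ∈ B} := by
  let ε : {b : S | (b : M) ∈ B} ≃ B :=
    { toFun := fun b => ⟨(b : S), b.2⟩
      invFun := fun b => ⟨⟨b, hB b.2⟩, b.2⟩
      left_inv := fun _ => rfl
      right_inv := fun _ => rfl }
  have hprod : ∀ n : {b : S | (b : M) ∈ B} →₀ ℕ,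
      ((n.prod fun b k => (b : S) ^ k : S) : M) =
        (n.equivMapDomain ε).prod fun b k => (b : M) ^ k := by
    intro n
    rw [Finsupp.prod_equivMapDomain, Finsupp.prod, Finsupp.prod, Submonoid.coe_finsetProd]
    rfl
  refine ⟨fun n m hnm => ?_, ?_⟩
  · have h1 := congrArg (Subtype.val : S → M) hnm
    dsimp only at h1
    rw [hprod, hprod] at h1
    exact (Finsupp.equivCongrLeft ε).injective (h.1 h1)
  · refine Set.eq_univ_of_forall fun s => ?_
    have hs : (s : M) ∈ Set.range (fun n : B →₀ ℕ => n.prod fun b k => (b : M) ^ k) := by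
      rw [h.2]; exact s.2
    obtain ⟨n, hn⟩ := hs
    refine ⟨n.equivMapDomain ε.symm, Subtype.ext ?_⟩
    dsimp only
    rw [hprod, ← hn, ← Finsupp.equivMapDomain_trans, ε.symm_trans_self,
      Finsupp.equivMapDomain_refl]

/-- In a reduced cancellative monoid distinct primes do not divide each other. -/
theorem IsPrimeElement.eq_of_dvd [IsCancelMul M] {p q : Associates M} (hp : IsPrimeElement p)
    (hq : IsPrimeElement q) (h : p ∣ q) : p = q := by
  obtain ⟨c, rfl⟩ := h
  rcases hq.2 p c dvd_rfl with h | ⟨d, hd⟩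
  · exact associates_antisymm (dvd_mul_right _ _) h
  · refine absurd (isUnit_of_dvd_one ⟨d, Eq.symm ?_⟩) hp.1
    apply mul_left_cancel (a := c)
    rw [mul_one, ← mul_assoc, mul_comm c p, ← hd]

end Monoids

/-! ### Uniqueness of divisor theories -/

section DivisorTheory

variable {H T T' : Type*} [CommMonoid H] [CommMonoid T] [CommMonoid T']

/-- The basis of a free abelian monoid as an isomorphism with the monoid of exponent vectors. -/
theorem IsFreeAbelianWithBasis.exists_equiv {P : Set T}
    (hP : IsFreeAbelianWithBasis (⊤ : Submonoid T) P) :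
    Nonempty (Multiplicative (P →₀ ℕ) ≃* T) := by
  classical
  let f : Multiplicative (P →₀ ℕ) →* T :=
    { toFun := fun n => (Multiplicative.toAdd n).prod fun b k => (b : T) ^ k
      map_one' := Finsupp.prod_zero_index
      map_mul' := fun a b => Finsupp.prod_add_index' (by simp) (fun _ _ _ => pow_add _ _ _) }
  refine ⟨MulEquiv.ofBijective f ⟨hP.1, fun t => ?_⟩⟩
  have : t ∈ Set.range (fun n : P →₀ ℕ => n.prod fun b k => (b : T) ^ k) := by
    rw [hP.2]; trivial
  exact this

theorem dvd_iff_le_of_equiv {P : Type*} (e : Multiplicative (P →₀ ℕ) ≃* T) (a b : T) :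
    a ∣ b ↔ Multiplicative.toAdd (e.symm a) ≤ Multiplicative.toAdd (e.symm b) := by
  rw [← map_dvd_iff e.symm]
  constructor
  · rintro ⟨c, hc⟩
    rw [hc]
    exact le_self_add
  · intro h
    obtain ⟨c, hc⟩ := exists_add_of_le h
    exact ⟨Multiplicative.ofAdd c, hc⟩

theorem IsFreeAbelianWithBasis.isCancelMul {P : Set T}
    (hP : IsFreeAbelianWithBasis (⊤ : Submonoid T) P) : IsCancelMul T := by
  obtain ⟨e⟩ := hP.exists_equiv
  exact e.symm.injective.isCancelMul _ (map_mul _)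

theorem IsFreeAbelianWithBasis.dvd_antisymm {P : Set T}
    (hP : IsFreeAbelianWithBasis (⊤ : Submonoid T) P) {a b : T} (h : a ∣ b) (h' : b ∣ a) :
    a = b := by
  obtain ⟨e⟩ := hP.exists_equiv
  rw [dvd_iff_le_of_equiv e] at h h'
  exact e.symm.injective (le_antisymm h h')

theorem IsFreeAbelianWithBasis.exists_isGcdOf {P : Set T}
    (hP : IsFreeAbelianWithBasis (⊤ : Submonoid T) P) {X : Set T} (hX : X.Finite)
    (hne : X.Nonempty) : ∃ d, IsGcdOf X d := by
  classical
  obtain ⟨e⟩ := hP.exists_equiv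
  lift X to Finset T using hX
  refine ⟨e (Multiplicative.ofAdd
    (X.inf' (Finset.coe_nonempty.1 hne) fun x => Multiplicative.toAdd (e.symm x))), fun x hx => ?_,
    fun c hc => ?_⟩
  · rw [dvd_iff_le_of_equiv e, e.symm_apply_apply]
    exact Finset.inf'_le _ (by simpa using hx)
  · rw [dvd_iff_le_of_equiv e, e.symm_apply_apply]
    refine Finset.le_inf' (Finset.coe_nonempty.1 hne) _ fun x hx => ?_
    exact (dvd_iff_le_of_equiv e _ _).1 (hc x (by simpa using hx))

/-- Multiplication distributes over greatest common divisors in a free abelian monoid. -/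
theorem IsGcdOf.dvd_mul {P : Set T} (hP : IsFreeAbelianWithBasis (⊤ : Submonoid T) P)
    {X : Set T} {d : T} (hd : IsGcdOf X d) (hX : X.Finite) (hne : X.Nonempty) {s c : T}
    (hc : ∀ x ∈ X, c ∣ s * x) : c ∣ s * d := by
  have := hP.isCancelMul
  obtain ⟨m, hm⟩ := hP.exists_isGcdOf (hX.image (s * ·)) (hne.image _)
  obtain ⟨k, rfl⟩ : s ∣ m := hm.2 s (by rintro _ ⟨x, -, rfl⟩; exact dvd_mul_right _ _)
  refine (hm.2 c (by rintro _ ⟨x, hx, rfl⟩; exact hc x hx)).trans (mul_dvd_mul_left _ ?_)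
  refine hd.2 k fun x hx => ?_
  obtain ⟨y, hy⟩ := hm.1 _ ⟨x, hx, rfl⟩
  exact ⟨y, mul_left_cancel (a := s) (by rw [← mul_assoc]; exact hy)⟩

theorem IsGcdOf.mul {P : Set T} (hP : IsFreeAbelianWithBasis (⊤ : Submonoid T) P)
    {X Y : Set T} {d e : T} (hd : IsGcdOf X d) (hX : X.Finite) (hXne : X.Nonempty)
    (he : IsGcdOf Y e) (hY : Y.Finite) (hYne : Y.Nonempty) : IsGcdOf (X * Y) (d * e) := by
  constructor
  · rintro _ ⟨x, hx, y, hy, rfl⟩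
    exact mul_dvd_mul (hd.1 x hx) (he.1 y hy)
  · intro c hc
    rw [mul_comm]
    refine hd.dvd_mul hP hX hXne fun x hx => ?_
    rw [mul_comm]
    exact he.dvd_mul hP hY hYne fun y hy => hc _ (Set.mul_mem_mul hx hy)

/-- In a divisor theory every element, not just every basis element, is the greatest common
divisor of finitely many images. -/
theorem IsDivisorTheory.exists_isGcdOf {θ : H →* T} (hθ : IsDivisorTheory θ) (t : T) :
    ∃ X : Set H, X.Finite ∧ X.Nonempty ∧ IsGcdOf (θ '' X) t := by
  obtain ⟨-, P, hP, hgcd⟩ := hθ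
  let S : Submonoid T :=
    { carrier := {t | ∃ X : Set H, X.Finite ∧ X.Nonempty ∧ IsGcdOf (θ '' X) t}
      one_mem' := ⟨{1}, Set.finite_singleton _, Set.singleton_nonempty _, by simp, by simp⟩
      mul_mem' := by
        rintro a b ⟨X, hX, hXne, ha⟩ ⟨Y, hY, hYne, hb⟩
        refine ⟨X * Y, hX.mul hY, hXne.mul hYne, ?_⟩
        rw [Set.image_mul]
        exact ha.mul hP (hX.image _) (hXne.image _) hb (hY.image _) (hYne.image _) }
  have ht : t ∈ Set.range (fun n : P →₀ ℕ => n.prod fun b k => (b : T) ^ k) := by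
    rw [hP.2]; trivial
  obtain ⟨n, rfl⟩ := ht
  exact S.prod_mem fun b _ => S.pow_mem (hgcd b b.2) _

/-- The elements of `H` divisible by the divisor `gcd θ(X)` form the `v`-ideal generated by `X`,
which is described in terms of `H` alone. -/
theorem IsDivisorTheory.dvd_iff {θ : H →* T} (hθ : IsDivisorTheory θ) {X : Set H}
    (hX : X.Finite) (hne : X.Nonempty) {t : T} (ht : IsGcdOf (θ '' X) t) (h : H) :
    t ∣ θ h ↔ ∀ a b : H, (∀ x ∈ X, a ∣ b * x) → a ∣ b * h := by
  obtain ⟨P, hP, -⟩ := hθ.2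
  constructor
  · intro hth a b hab
    apply hθ.1
    rw [map_mul]
    refine (ht.dvd_mul hP (hX.image _) (hne.image _) ?_).trans (mul_dvd_mul_left _ hth)
    rintro _ ⟨x, hx, rfl⟩
    rw [← map_mul]
    exact map_dvd θ (hab x hx)
  · intro hab
    have := hP.isCancelMul
    obtain ⟨x₀, hx₀⟩ := hne
    -- `y` is a complement of `t` to an element of `H`, and a gcd of elements of `H` itself
    obtain ⟨y, hy⟩ := ht.1 _ ⟨x₀, hx₀, rfl⟩
    obtain ⟨Y, hY, hYne, hgcd⟩ := hθ.exists_isGcdOf y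
    have h1 : t * y ∣ θ h * y := by
      refine hgcd.dvd_mul hP (hY.image _) (hYne.image _) ?_
      rintro _ ⟨b, hb, rfl⟩
      rw [← map_mul, ← hy, mul_comm h]
      refine map_dvd θ (hab x₀ b fun x hx => hθ.1 _ _ ?_)
      rw [hy, map_mul, mul_comm]
      exact mul_dvd_mul (hgcd.1 _ ⟨b, hb, rfl⟩) (ht.1 _ ⟨x, hx, rfl⟩)
    obtain ⟨z, hz⟩ := h1
    exact ⟨z, mul_right_cancel (b := y) (by rw [hz]; ac_rfl)⟩

theorem IsDivisorTheory.dvd_of_forall {θ : H →* T} (hθ : IsDivisorTheory θ) {s t : T}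
    (h : ∀ x, s ∣ θ x → t ∣ θ x) : t ∣ s := by
  obtain ⟨X, -, -, hX⟩ := hθ.exists_isGcdOf s
  refine hX.2 t ?_
  rintro _ ⟨x, hx, rfl⟩
  exact h x (hX.1 _ ⟨x, hx, rfl⟩)

theorem IsDivisorTheory.eq_of_forall {θ : H →* T} (hθ : IsDivisorTheory θ) {s t : T}
    (h : ∀ x, s ∣ θ x ↔ t ∣ θ x) : s = t := by
  obtain ⟨P, hP, -⟩ := hθ.2
  exact hP.dvd_antisymm (hθ.dvd_of_forall fun x => (h x).2) (hθ.dvd_of_forall fun x => (h x).1)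

/-- Divisors of two divisor theories of `H` with the same multiples in `H` are greatest common
divisors of the same finite sets. -/
theorem IsDivisorTheory.isGcdOf_of_forall {θ : H →* T} {θ' : H →* T'} (hθ : IsDivisorTheory θ)
    (hθ' : IsDivisorTheory θ') {X : Set H} (hX : X.Finite) (hne : X.Nonempty) {t : T} {t' : T'}
    (ht : IsGcdOf (θ '' X) t) (h : ∀ x, t ∣ θ x ↔ t' ∣ θ' x) : IsGcdOf (θ' '' X) t' := by
  obtain ⟨P, hP, -⟩ := hθ'.2
  obtain ⟨d, hd⟩ := hP.exists_isGcdOf (hX.image θ') (hne.image _)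
  have : d = t' := hθ'.eq_of_forall fun x => by
    rw [← h, hθ.dvd_iff hX hne ht, hθ'.dvd_iff hX hne hd]
  exact this ▸ hd

/-- A monoid has at most one divisor theory up to isomorphism: divisors with the same multiples
in `H` correspond to each other. -/
theorem IsDivisorTheory.exists_equiv {θ : H →* T} {θ' : H →* T'} (hθ : IsDivisorTheory θ)
    (hθ' : IsDivisorTheory θ') : ∃ e : T ≃* T', ∀ h, e (θ h) = θ' h := by
  obtain ⟨P, hP, -⟩ := hθ.2
  obtain ⟨P', hP', -⟩ := hθ'.2
  have h1 : ∀ t : T, ∃ t' : T', ∀ x, t ∣ θ x ↔ t' ∣ θ' x := fun t => by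
    obtain ⟨X, hX, hne, ht⟩ := hθ.exists_isGcdOf t
    obtain ⟨d, hd⟩ := hP'.exists_isGcdOf (hX.image θ') (hne.image _)
    exact ⟨d, fun x => by rw [hθ.dvd_iff hX hne ht, hθ'.dvd_iff hX hne hd]⟩
  have h2 : ∀ t' : T', ∃ t : T, ∀ x, t ∣ θ x ↔ t' ∣ θ' x := fun t => by
    obtain ⟨X, hX, hne, ht⟩ := hθ'.exists_isGcdOf t
    obtain ⟨d, hd⟩ := hP.exists_isGcdOf (hX.image θ) (hne.image _)
    exact ⟨d, fun x => by rw [hθ.dvd_iff hX hne hd, hθ'.dvd_iff hX hne ht]⟩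
  choose F hF using h1
  have hFmul : ∀ s t, F (s * t) = F s * F t := by
    intro s t
    obtain ⟨X, hX, hXne, hs⟩ := hθ.exists_isGcdOf s
    obtain ⟨Y, hY, hYne, ht⟩ := hθ.exists_isGcdOf t
    have h3 := hs.mul hP (hX.image _) (hXne.image _) ht (hY.image _) (hYne.image _)
    have h4 := (hθ.isGcdOf_of_forall hθ' hX hXne hs (hF s)).mul hP' (hX.image _) (hXne.image _)
      (hθ.isGcdOf_of_forall hθ' hY hYne ht (hF t)) (hY.image _) (hYne.image _)
    rw [← Set.image_mul] at h3 h4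
    refine hθ'.eq_of_forall fun x => ?_
    rw [← hF, hθ.dvd_iff (hX.mul hY) (hXne.mul hYne) h3,
      hθ'.dvd_iff (hX.mul hY) (hXne.mul hYne) h4]
  have hbij : Function.Bijective F := by
    refine ⟨fun s t hst => hθ.eq_of_forall fun x => by rw [hF, hF, hst], fun t' => ?_⟩
    obtain ⟨t, ht⟩ := h2 t'
    exact ⟨t, hθ'.eq_of_forall fun x => by rw [← hF, ht]⟩
  refine ⟨{ Equiv.ofBijective F hbij with map_mul' := hFmul }, fun h => ?_⟩
  refine hθ'.eq_of_forall fun x => ?_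
  exact (hF (θ h) x).symm.trans
    ⟨fun hx => map_dvd θ' (hθ.1 _ _ hx), fun hx => map_dvd θ (hθ'.1 _ _ hx)⟩

end DivisorTheory

/-! ### Polynomials, units and the embeddings of monoids -/

section Polynomials

universe u v

variable {F : Type u} [Field F] {V : Type v} [AddCommGroup V] [Module F V]

instance uniqueFactorizationMonoidPoly : UniqueFactorizationMonoid (Poly F V) :=
  (SymmetricAlgebra.equivMvPolynomial
    (Module.Free.chooseBasis F (Module.Dual F V))).symm.toMulEquiv.uniqueFactorizationMonoid
    inferInstance

theorem isUnit_poly_iff {f : Poly F V} :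
    IsUnit f ↔ ∃ c : Fˣ, f = algebraMap F (Poly F V) c := by
  constructor
  · intro hf
    let e := SymmetricAlgebra.equivMvPolynomial (Module.Free.chooseBasis F (Module.Dual F V))
    obtain ⟨r, hr, hf⟩ := MvPolynomial.isUnit_iff_eq_C_of_isReduced.1 (hf.map e)
    obtain ⟨c, rfl⟩ := hr
    refine ⟨c, e.injective ?_⟩
    rw [hf, AlgEquiv.commutes, MvPolynomial.algebraMap_eq]
  · rintro ⟨c, rfl⟩
    exact c.isUnit.map _

theorem act_mul (g h : LinearMap.GeneralLinearGroup F V) (f : Poly F V) :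
    act F V (g * h) f = act F V g (act F V h f) := by
  rw [map_mul, AlgHom.mul_apply]

theorem act_ι (g : LinearMap.GeneralLinearGroup F V) (x : Module.Dual F V) :
    act F V g (SymmetricAlgebra.ι F _ x) = SymmetricAlgebra.ι F _
      (LinearMap.dualMap ((g⁻¹ : LinearMap.GeneralLinearGroup F V) : V →ₗ[F] V) x) :=
  SymmetricAlgebra.lift_ι_apply _ _

theorem isCancelMul_of_forall_ne_zero (S : Submonoid (Poly F V)) (hS : ∀ f ∈ S, f ≠ 0) :
    IsCancelMul S :=
  have : IsLeftCancelMul S := ⟨fun a _ _ h =>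
    Subtype.ext (mul_left_cancel₀ (hS a a.2) (congrArg Subtype.val h))⟩
  CommMagma.IsLeftCancelMul.toIsCancelMul _

instance isCancelMulPolyMonoid : IsCancelMul (polyMonoid F V) :=
  isCancelMul_of_forall_ne_zero _ fun _ hf => hf

theorem polyMonoid_dvd_iff {a b : polyMonoid F V} : a ∣ b ↔ (a : Poly F V) ∣ b := by
  constructor
  · rintro ⟨c, rfl⟩
    exact ⟨c, rfl⟩
  · rintro ⟨c, hc⟩
    exact ⟨⟨c, fun h => b.2 (by rw [hc, h, mul_zero])⟩, Subtype.ext hc⟩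

variable (G : Subgroup (LinearMap.GeneralLinearGroup F V))

instance isCancelMulRelMonoid : IsCancelMul (relMonoid G) :=
  isCancelMul_of_forall_ne_zero _ fun _ hf => hf.2

instance isCancelMulInvMonoid : IsCancelMul (invMonoid G) :=
  isCancelMul_of_forall_ne_zero _ fun _ hf => hf.2

variable {G}

theorem relInvariants_pow {χ : G →* Fˣ} {a : Poly F V} (ha : a ∈ relInvariants G χ) (n : ℕ) :
    a ^ n ∈ relInvariants G (χ ^ n) := fun g => by
  rw [map_pow, ha g, smul_pow, MonoidHom.pow_apply, Units.val_pow_eq_pow_val]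

theorem relInvariants_of_mul {χ η : G →* Fˣ} {a b : Poly F V} (ha0 : a ≠ 0)
    (ha : a ∈ relInvariants G χ) (hab : a * b ∈ relInvariants G η) :
    b ∈ relInvariants G (η * χ⁻¹) := fun g => by
  have h := hab g
  rw [map_mul, ha g, smul_mul_assoc] at h
  apply mul_left_cancel₀ ha0
  rw [MonoidHom.mul_apply, MonoidHom.inv_apply, mul_comm (η g), Units.val_mul, mul_smul,
    mul_smul_comm, mul_smul_comm, ← h, smul_smul, Units.inv_mul, one_smul]

theorem mem_invariants_iff {f : Poly F V} : f ∈ invariants G ↔ f ∈ relInvariants G 1 := by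
  constructor
  · intro h g
    rw [h g g.2]
    simp
  · intro h g hg
    rw [h ⟨g, hg⟩]
    simp

theorem pow_card_eq_one [Finite G] (χ : G →* Fˣ) : χ ^ Nat.card G = 1 := by
  ext g
  rw [MonoidHom.pow_apply, ← map_pow, pow_card_eq_one', map_one, MonoidHom.one_apply]

theorem isDivisorHom_embInvRel : IsDivisorHom (embInvRel G) := by
  rintro a b ⟨c, hc⟩
  have hc' : (b : Poly F V) = a * c := congrArg Subtype.val hc
  refine ⟨⟨c, mem_invariants_iff.2 ?_, c.2.2⟩, Subtype.ext hc'⟩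
  have := relInvariants_of_mul a.2.2 (mem_invariants_iff.1 a.2.1)
    (hc' ▸ mem_invariants_iff.1 b.2.1)
  have h1 : (1 : G →* Fˣ) * 1⁻¹ = 1 := by ext; simp
  rwa [h1] at this

theorem pow_card_mem_range_embInvRel [Finite G] (a : relMonoid G) :
    a ^ Nat.card G ∈ Set.range (embInvRel G) := by
  obtain ⟨χ, hχ⟩ := a.2.1
  refine ⟨⟨(a : Poly F V) ^ Nat.card G, mem_invariants_iff.2 ?_, pow_ne_zero _ a.2.2⟩, rfl⟩
  rw [← pow_card_eq_one χ]
  exact relInvariants_pow hχ _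

theorem isCofinalHom_embInvRel [Finite G] : IsCofinalHom (embInvRel G) := by
  intro a
  obtain ⟨b, hb⟩ := pow_card_mem_range_embInvRel a
  exact ⟨b, hb ▸ dvd_pow_self a Nat.card_pos.ne'⟩

theorem isDivisorHom_embRelPoly : IsDivisorHom (embRelPoly G) := by
  rintro a b ⟨c, hc⟩
  have hc' : (b : Poly F V) = a * c := congrArg Subtype.val hc
  obtain ⟨χ, hχ⟩ := a.2.1
  obtain ⟨η, hη⟩ := b.2.1
  exact ⟨⟨c, ⟨_, relInvariants_of_mul a.2.2 hχ (hc' ▸ hη)⟩, c.2⟩, Subtype.ext hc'⟩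

/-- The norm `∏ g · f` is an invariant multiple of `f`. -/
theorem isCofinalHom_embRelPoly [Finite G] : IsCofinalHom (embRelPoly G) := by
  classical
  have := Fintype.ofFinite G
  intro f
  refine ⟨⟨∏ g : G, act F V g f, ⟨1, mem_invariants_iff.1 fun h hh => ?_⟩, ?_⟩, ?_⟩
  · rw [map_prod]
    refine Fintype.prod_equiv (Equiv.mulLeft (⟨h, hh⟩ : G)) _ _ fun g => ?_
    rw [← act_mul]
    rfl
  · exact Finset.prod_ne_zero_iff.2 fun g _ => act_ne_zero _ f.2
  · rw [polyMonoid_dvd_iff]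
    have h := Finset.dvd_prod_of_mem (fun g : G => act F V g f) (Finset.mem_univ 1)
    rwa [OneMemClass.coe_one, map_one] at h

end Polynomials

/-! ### Inertia groups and relative invariants outside a prime ideal -/

section Inertia

variable {F R Γ : Type*} [Field F] [CommRing R] [Algebra F R] [Group Γ]

/-- The inertia group of the ideal `𝔭`: the elements acting trivially on the quotient by `𝔭`. -/
def inertia (ρ : Γ →* (R →ₐ[F] R)) (𝔭 : Ideal R) : Subgroup Γ where
  carrier := {g | ∀ a, ρ g a - a ∈ 𝔭}
  one_mem' a := by simp
  mul_mem' {g h} hg hh a := by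
    have := 𝔭.add_mem (hg (ρ h a)) (hh a)
    rwa [sub_add_sub_cancel, ← AlgHom.mul_apply, ← map_mul] at this
  inv_mem' {g} hg a := by
    have := 𝔭.neg_mem (hg (ρ g⁻¹ a))
    rwa [neg_sub, ← AlgHom.mul_apply, ← map_mul, mul_inv_cancel, map_one, AlgHom.one_apply] at this

/-- The multiplicative monoid of elements of `R` fixed by a subgroup. -/
def fixedMonoid (ρ : Γ →* (R →ₐ[F] R)) (I : Subgroup Γ) : Submonoid R where
  carrier := {a | ∀ i ∈ I, ρ i a = a}
  one_mem' _ _ := map_one _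
  mul_mem' ha hb i hi := by rw [map_mul, ha i hi, hb i hi]

/-- An element acting trivially, modulo a prime `𝔭`, on the elements fixed by the inertia group
already belongs to the inertia group. Indeed the polynomial `∏ (X - i a)` over the inertia group
has fixed coefficients and is `(X - a) ^ n` modulo `𝔭`; as `g` fixes it modulo `𝔭`, its zero `g a`
satisfies `(g a - a) ^ n ∈ 𝔭`. -/
theorem mem_inertia_of_forall_fixed [Finite Γ] (ρ : Γ →* (R →ₐ[F] R)) (𝔭 : Ideal R) [𝔭.IsPrime]
    {g : Γ} (hg : ∀ a ∈ fixedMonoid ρ (inertia ρ 𝔭), ρ g a - a ∈ 𝔭) : g ∈ inertia ρ 𝔭 := by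
  classical
  have := Fintype.ofFinite (inertia ρ 𝔭)
  intro a
  let π := Ideal.Quotient.mk 𝔭
  let P : Polynomial R := ∏ i : inertia ρ 𝔭, (Polynomial.X - Polynomial.C (ρ i a))
  have hfix : ∀ k, P.coeff k ∈ fixedMonoid ρ (inertia ρ 𝔭) := by
    intro k j hj
    have : P.map (ρ j : R →+* R) = P := by
      rw [Polynomial.map_prod]
      refine Fintype.prod_equiv (Equiv.mulLeft (⟨j, hj⟩ : inertia ρ 𝔭)) _ _ fun i => ?_
      simp [map_mul]
    conv_rhs => rw [← this]
    rw [Polynomial.coeff_map]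
    rfl
  have h1 : P.map π = (Polynomial.X - Polynomial.C (π a)) ^ Fintype.card (inertia ρ 𝔭) := by
    rw [Polynomial.map_prod, ← Finset.card_univ]
    refine Finset.prod_eq_pow_card fun i _ => ?_
    rw [Polynomial.map_sub, Polynomial.map_X, Polynomial.map_C]
    have : π (ρ i a) = π a := Ideal.Quotient.eq.2 (i.2 a)
    rw [this]
  have h2 : P.map (π.comp (ρ g : R →+* R)) = P.map π := by
    ext k
    rw [Polynomial.coeff_map, Polynomial.coeff_map]
    exact Ideal.Quotient.eq.2 (hg _ (hfix k))
  have h3 : (P.map (π.comp (ρ g : R →+* R))).eval (π (ρ g a)) = 0 := by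
    rw [Polynomial.map_prod, Polynomial.eval_prod]
    refine Finset.prod_eq_zero (Finset.mem_univ 1) ?_
    simp
  rw [h2, h1] at h3
  have h4 : (π (ρ g a) - π a) ^ Fintype.card (inertia ρ 𝔭) = 0 := by simpa using h3
  rw [← map_sub] at h4
  exact Ideal.Quotient.eq_zero_iff_mem.1 (pow_eq_zero_iff Fintype.card_ne_zero |>.1 h4)

/-- If a character of a finite group is trivial on the inertia group of a prime `𝔭`, some relative
invariant of that weight lies outside `𝔭`. The invariant is a twisted sum over the cosets of the
inertia group, rather than over the group: if the characteristic divides the order of the inertia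
group, the sum over the group vanishes modulo `𝔭`. The homomorphisms `a ↦ g a` modulo `𝔭` on the
elements fixed by the inertia group differ from the identity for every nontrivial coset, so
linear independence of homomorphisms applies. -/
theorem exists_relInvariant_notMem [Finite Γ] (ρ : Γ →* (R →ₐ[F] R)) (𝔭 : Ideal R) [𝔭.IsPrime]
    (χ : Γ →* Fˣ) (hχ : ∀ g ∈ inertia ρ 𝔭, χ g = 1) :
    ∃ f : R, (∀ g, ρ g f = (χ g : F) • f) ∧ f ∉ 𝔭 := by
  classical
  set I := inertia ρ 𝔭 with hI
  have := Fintype.ofFinite (Γ ⧸ I)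
  let S := fixedMonoid ρ I
  let π := Ideal.Quotient.mk 𝔭
  -- the term of the twisted sum at a coset, independent of the representative since `χ` is trivial
  -- on `I` and the elements of `S` are fixed by `I`
  let t : S → Γ ⧸ I → R := fun a c => ((χ c.out)⁻¹ : Fˣ).val • ρ c.out a
  have ht : ∀ (a : S) (g : Γ), t a (g : Γ ⧸ I) = ((χ g)⁻¹ : Fˣ).val • ρ g a := by
    intro a g
    obtain ⟨i, hi⟩ := QuotientGroup.mk_out_eq_mul I g
    simp only [t]
    rw [hi, map_mul, hχ i i.2, mul_one, map_mul, AlgHom.mul_apply, a.2 i i.2]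
  have hrel : ∀ (a : S) (g : Γ), ρ g (∑ c, t a c) = (χ g : F) • ∑ c, t a c := by
    intro a g
    rw [map_sum, Finset.smul_sum]
    refine Fintype.sum_equiv (MulAction.toPerm g) _ _ fun c => ?_
    obtain ⟨h, rfl⟩ := QuotientGroup.mk_surjective c
    have : MulAction.toPerm g (h : Γ ⧸ I) = ((g * h : Γ) : Γ ⧸ I) := rfl
    rw [this, ht, ht, map_smul, smul_smul, ← Units.val_mul, map_mul, map_mul, mul_inv_rev,
      mul_comm (χ g), inv_mul_cancel_right, AlgHom.mul_apply]
  by_contra! hcon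
  -- only the trivial coset contributes to the coefficient of the identity `σ 1` in the relation
  -- `x` between the homomorphisms `σ g`, so this coefficient is a unit
  let σ : Γ → (S →* R ⧸ 𝔭) := fun g =>
    (π : R →* R ⧸ 𝔭).comp ((ρ g : R →* R).comp S.subtype)
  have hσ : ∀ g, σ g = σ 1 ↔ g ∈ I := by
    intro g
    constructor
    · intro h
      refine mem_inertia_of_forall_fixed ρ 𝔭 fun a ha => ?_
      have := DFunLike.congr_fun h ⟨a, ha⟩
      simpa [σ, π] using Ideal.Quotient.eq.1 this
    · intro h
      ext a
      refine Ideal.Quotient.eq.2 ?_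
      simpa using h a
  let k : Γ ⧸ I → R ⧸ 𝔭 := fun c => algebraMap F (R ⧸ 𝔭) ((χ c.out)⁻¹ : Fˣ).val
  let x : (S →* R ⧸ 𝔭) →₀ (R ⧸ 𝔭) := ∑ c, Finsupp.single (σ c.out) (k c)
  have hx : x = 0 := by
    refine linearIndependent_iff.1 (linearIndependent_monoidHom S (R ⧸ 𝔭)) x ?_
    rw [map_sum]
    ext a
    have h0 : π (∑ c, t a c) = 0 := Ideal.Quotient.eq_zero_iff_mem.2 (hcon _ (hrel a))
    rw [map_sum] at h0
    rw [Finset.sum_apply, Pi.zero_apply, ← h0]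
    refine Finset.sum_congr rfl fun c _ => ?_
    rw [Finsupp.linearCombination_single]
    simp only [t, Algebra.smul_def, map_mul]
    rfl
  have h1 : x (σ 1) = k (1 : Γ) := by
    rw [Finsupp.finsetSum_apply, Finset.sum_eq_single ((1 : Γ) : Γ ⧸ I)]
    · obtain ⟨i, hi⟩ := QuotientGroup.mk_out_eq_mul I 1
      rw [(hσ _).2, Finsupp.single_eq_same]
      rw [hi, one_mul]
      exact i.2
    · intro c _ hc
      rw [Finsupp.single_apply, if_neg]
      intro h
      apply hc
      rw [← QuotientGroup.out_eq' c]
      refine QuotientGroup.eq.2 ?_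
      rw [mul_one]
      exact I.inv_mem ((hσ _).1 h)
    · intro h
      exact absurd (Finset.mem_univ _) h
  rw [hx, Finsupp.zero_apply] at h1
  have h2 : IsUnit (k (1 : Γ)) := (Units.isUnit _).map _
  rw [← h1] at h2
  exact not_isUnit_zero h2

end Inertia

/-! ### Linear forms and pseudoreflections -/

section Reflections

universe u v

variable {F : Type u} [Field F] {V : Type v} [AddCommGroup V] [Module F V]

theorem prime_ι {y : Module.Dual F V} (hy : y ≠ 0) :
    Prime (SymmetricAlgebra.ι F (Module.Dual F V) y) := by
  have hli : LinearIndepOn F id ({y} : Set (Module.Dual F V)) := LinearIndepOn.singleton hy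
  let b := Module.Basis.extend hli
  have hmem : y ∈ hli.extend (Set.subset_univ _) :=
    Module.Basis.subset_extend hli (Set.mem_singleton y)
  have hby : b ⟨y, hmem⟩ = y := Module.Basis.extend_apply_self hli _
  have hX := SymmetricAlgebra.equivMvPolynomial_ι_apply b ⟨y, hmem⟩
  rw [hby] at hX
  rw [← MulEquiv.prime_iff (SymmetricAlgebra.equivMvPolynomial b), hX]
  exact MvPolynomial.X_prime

theorem exists_smul_of_ι_dvd {y z : Module.Dual F V} (hy : y ≠ 0)
    (h : SymmetricAlgebra.ι F (Module.Dual F V) y ∣ SymmetricAlgebra.ι F _ z) :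
    ∃ c : F, z = c • y := by
  rcases eq_or_ne z 0 with rfl | hz
  · exact ⟨0, by simp⟩
  obtain ⟨u, hu⟩ := (prime_ι hy).associated_of_dvd (prime_ι hz) h
  obtain ⟨c, hc⟩ := isUnit_poly_iff.1 u.isUnit
  refine ⟨c, ?_⟩
  by_contra hne
  refine (prime_ι (sub_ne_zero.2 hne)).ne_zero ?_
  rw [map_sub, map_smul, ← hu, hc, mul_comm, ← Algebra.smul_def, sub_self]

/-- A hyperplane is defined by one linear form, of which every linear form vanishing on the
hyperplane is a multiple. -/
theorem exists_dual_of_isCoatom {W : Submodule F V} (hW : IsCoatom W) :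
    ∃ y : Module.Dual F V, y ≠ 0 ∧
      ∀ x : Module.Dual F V, (∀ v ∈ W, x v = 0) → ∃ c : F, x = c • y := by
  obtain ⟨u, hu⟩ : ∃ u, u ∉ W := by
    by_contra! h
    exact hW.1 (eq_top_iff.2 fun v _ => h v)
  obtain ⟨y, hyu, hyW⟩ := Submodule.exists_le_ker_of_notMem hu
  refine ⟨y, fun h => hyu (by simp [h]), fun x hx => ⟨x u / y u, ?_⟩⟩
  have hker : LinearMap.ker (x - (x u / y u) • y) = ⊤ := by
    refine hW.2 _ (lt_of_le_of_ne (fun v hv => ?_) ?_)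
    · have : y v = 0 := hyW hv
      simp [hx v hv, this]
    · intro h
      apply hu
      rw [h]
      simp [hyu]
  exact sub_eq_zero.1 (LinearMap.ker_eq_top.1 hker)

theorem isCoatom_ker_dual {y : Module.Dual F V} (hy : y ≠ 0) : IsCoatom (LinearMap.ker y) := by
  refine ⟨fun h => hy (LinearMap.ker_eq_top.1 h), fun W hW => ?_⟩
  obtain ⟨u, huW, hu⟩ := SetLike.exists_of_lt hW
  rw [LinearMap.mem_ker] at hu
  rw [eq_top_iff]
  intro v _
  have h1 : v - (y v / y u) • u ∈ W := hW.le (by simp [hu])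
  simpa using W.add_mem h1 (W.smul_mem (y v / y u) huW)

theorem inv_apply_apply (g : LinearMap.GeneralLinearGroup F V) (v : V) :
    ((g⁻¹ : LinearMap.GeneralLinearGroup F V) : V →ₗ[F] V) ((g : V →ₗ[F] V) v) = v := by
  have h : ((g⁻¹ : LinearMap.GeneralLinearGroup F V) : Module.End F V) * g = 1 := Units.inv_mul g
  exact LinearMap.congr_fun h v

theorem apply_inv_apply (g : LinearMap.GeneralLinearGroup F V) (v : V) :
    (g : V →ₗ[F] V) (((g⁻¹ : LinearMap.GeneralLinearGroup F V) : V →ₗ[F] V) v) = v := by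
  have h : (g : Module.End F V) * (g⁻¹ : LinearMap.GeneralLinearGroup F V) = 1 := Units.mul_inv g
  exact LinearMap.congr_fun h v

/-- The action on polynomials is faithful. -/
theorem eq_one_of_forall_act_eq {g : LinearMap.GeneralLinearGroup F V}
    (h : ∀ x, act F V g (SymmetricAlgebra.ι F _ x) = SymmetricAlgebra.ι F _ x) : g = 1 := by
  rw [← inv_eq_one]
  apply Units.ext
  refine LinearMap.ext fun v => ?_
  rw [← sub_eq_zero, ← Module.forall_dual_apply_eq_zero_iff F]
  intro x
  by_contra hne
  have hx : LinearMap.dualMap ((g⁻¹ : LinearMap.GeneralLinearGroup F V) : V →ₗ[F] V) x - x ≠ 0 :=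
    fun h0 => hne (by rw [map_sub]; exact LinearMap.congr_fun h0 v)
  refine (prime_ι hx).ne_zero ?_
  rw [map_sub, ← act_ι, h, sub_self]

/-- A pseudoreflection acts trivially modulo the linear form defining its hyperplane. -/
theorem IsPseudoreflection.exists_ι_dvd {g : LinearMap.GeneralLinearGroup F V}
    (hg : IsPseudoreflection g) : ∃ p : Poly F V, Prime p ∧ ∀ a, p ∣ act F V g a - a := by
  obtain ⟨-, ⟨W, hW, hgW⟩, -⟩ := hg
  obtain ⟨y, hy, hyW⟩ := exists_dual_of_isCoatom hW
  set p := SymmetricAlgebra.ι F (Module.Dual F V) y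
  refine ⟨p, prime_ι hy, ?_⟩
  have h : (Ideal.Quotient.mkₐ F (Ideal.span {p})).comp (act F V g) =
      Ideal.Quotient.mkₐ F (Ideal.span {p}) := by
    apply SymmetricAlgebra.algHom_ext
    refine LinearMap.ext fun x => Ideal.Quotient.eq.2 ?_
    rw [Ideal.mem_span_singleton]
    have h1 := act_ι g x
    obtain ⟨c, hc⟩ := hyW (LinearMap.dualMap
      ((g⁻¹ : LinearMap.GeneralLinearGroup F V) : V →ₗ[F] V) x - x) fun v hv => by
        have := inv_apply_apply g v
        rw [hgW v hv] at this
        simp [this]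
    change p ∣ act F V g (SymmetricAlgebra.ι F _ x) - SymmetricAlgebra.ι F _ x
    rw [h1, ← map_sub, hc, map_smul, Algebra.smul_def]
    exact dvd_mul_left _ _
  intro a
  exact Ideal.mem_span_singleton.1 (Ideal.Quotient.eq.1 (DFunLike.congr_fun h a))

/-- A nontrivial element acting trivially modulo a prime `p` fixes a hyperplane pointwise, whose
equation is `p` up to a constant factor; unless it is a pseudoreflection it fixes this equation. -/
theorem isPseudoreflection_or_exists_ι {g : LinearMap.GeneralLinearGroup F V} (hg : g ≠ 1)
    {p : Poly F V} (hp : Prime p) (h : ∀ a, p ∣ act F V g a - a) :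
    IsPseudoreflection g ∨ ∃ q, Prime q ∧ (∀ a, q ∣ act F V g a - a) ∧ act F V g q = q := by
  obtain ⟨x, hx⟩ : ∃ x, act F V g (SymmetricAlgebra.ι F _ x) ≠ SymmetricAlgebra.ι F _ x := by
    by_contra! h0
    exact hg (eq_one_of_forall_act_eq h0)
  set D := LinearMap.dualMap ((g⁻¹ : LinearMap.GeneralLinearGroup F V) : V →ₗ[F] V) with hD
  have hact : ∀ x, act F V g (SymmetricAlgebra.ι F _ x) = SymmetricAlgebra.ι F _ (D x) := act_ι g
  obtain ⟨y, hyx⟩ : ∃ y, D x - x = y := ⟨_, rfl⟩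
  have hy : y ≠ 0 := by
    rintro rfl
    exact hx (by rw [hact, sub_eq_zero.1 hyx])
  have hpy : Associated p (SymmetricAlgebra.ι F _ y) :=
    hp.associated_of_dvd (prime_ι hy) (by rw [← hyx, map_sub, ← hact]; exact h _)
  have hι : ∀ a, SymmetricAlgebra.ι F _ y ∣ act F V g a - a := fun a =>
    hpy.symm.dvd.trans (h a)
  have hDx : ∀ z, ∃ c : F, D z - z = c • y := fun z => by
    refine exists_smul_of_ι_dvd hy ?_
    rw [map_sub, ← hact]
    exact hι _
  obtain ⟨c, hc⟩ := hDx y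
  rcases eq_or_ne c 0 with rfl | hc0
  · right
    refine ⟨_, prime_ι hy, hι, ?_⟩
    rw [hact, sub_eq_zero.1 (hc.trans (zero_smul _ _))]
  left
  refine ⟨hg, ⟨_, isCoatom_ker_dual hy, fun v hv => ?_⟩, ?_⟩
  · have h1 : ((g⁻¹ : LinearMap.GeneralLinearGroup F V) : V →ₗ[F] V) v = v := by
      rw [← sub_eq_zero, ← Module.forall_dual_apply_eq_zero_iff F]
      intro z
      obtain ⟨d, hd⟩ := hDx z
      have := LinearMap.congr_fun hd v
      rw [LinearMap.smul_apply, LinearMap.mem_ker.1 hv, smul_zero] at this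
      rw [map_sub]
      exact this
    conv_lhs => rw [← h1]
    exact apply_inv_apply g v
  · rintro ⟨n, hn⟩
    -- `y` is an eigenvector of the transpose of `g - 1`, with eigenvalue `-c / (1 + c)`; the
    -- identities avoid the division
    have h2 : ∀ v, (1 + c) * y ((g : V →ₗ[F] V) v) = y v := fun v => by
      have := LinearMap.congr_fun hc ((g : V →ₗ[F] V) v)
      have h3 : D y ((g : V →ₗ[F] V) v) = y v := congrArg y (inv_apply_apply g v)
      rw [LinearMap.sub_apply, h3, LinearMap.smul_apply, smul_eq_mul] at this
      linear_combination -this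
    have h3 : ∀ (k : ℕ) (v : V),
        (1 + c) ^ k * y ((((g : Module.End F V) - 1) ^ k) v) = (-c) ^ k * y v := by
      intro k
      induction k with
      | zero => intro v; simp
      | succ k ih =>
        intro v
        rw [pow_succ ((g : Module.End F V) - 1), Module.End.mul_apply, pow_succ, mul_right_comm,
          ih, LinearMap.sub_apply, map_sub, Module.End.one_apply]
        linear_combination (-c) ^ k * h2 v
    apply hy
    refine LinearMap.ext fun v => ?_
    have h4 := h3 n v
    rw [hn, LinearMap.zero_apply, map_zero, mul_zero, eq_comm, mul_eq_zero] at h4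
    exact h4.resolve_left (pow_ne_zero _ (neg_ne_zero.2 hc0))

variable {G : Subgroup (LinearMap.GeneralLinearGroup F V)}

/-- If `g` acts trivially modulo `p`, then `(χ g - 1) f = g f - f` is divisible by `p`. -/
theorem eq_one_of_not_dvd {g : G} {p : Poly F V} (h : ∀ a, p ∣ act F V g a - a)
    {χ : G →* Fˣ} {f : Poly F V} (hf : f ∈ relInvariants G χ) (hpf : ¬ p ∣ f) : χ g = 1 := by
  by_contra hne
  have hc : (χ g : F) - 1 ≠ 0 := fun h0 => hne (Units.ext (sub_eq_zero.1 h0))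
  apply hpf
  have h1 := h f
  rw [hf g] at h1
  have h2 : f = algebraMap F (Poly F V) ((χ g : F) - 1)⁻¹ * ((χ g : F) • f - f) := by
    nth_rewrite 3 [← one_smul F f]
    rw [← sub_smul, ← Algebra.smul_def, smul_smul, inv_mul_cancel₀ hc, one_smul]
  rw [h2]
  exact h1.mul_left _

/-- If `g` acts trivially modulo `p` and also fixes `p`, the weight of every nonzero relative
invariant is trivial on `g`: all powers of `p` can be split off before reducing modulo `p`. -/
theorem eq_one_of_act_eq {g : G} {p : Poly F V} (hp : Prime p) (h : ∀ a, p ∣ act F V g a - a)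
    (hgp : act F V g p = p) {χ : G →* Fˣ} {f : Poly F V} (hf : f ∈ relInvariants G χ)
    (hf0 : f ≠ 0) : χ g = 1 := by
  obtain ⟨e, hfe, hpe⟩ :=
    (FiniteMultiplicity.of_not_isUnit hp.not_isUnit hf0).exists_eq_pow_mul_and_not_dvd
  by_contra hne
  have hc : (χ g : F) - 1 ≠ 0 := fun h0 => hne (Units.ext (sub_eq_zero.1 h0))
  have h1 := hf g
  rw [hfe, map_mul, map_pow, hgp, ← mul_smul_comm] at h1
  have h2 : act F V g e = (χ g : F) • e := mul_left_cancel₀ (pow_ne_zero _ hp.ne_zero) h1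
  apply hpe
  have h3 := h e
  have h4 : e = algebraMap F (Poly F V) ((χ g : F) - 1)⁻¹ * ((χ g : F) • e - e) := by
    nth_rewrite 3 [← one_smul F e]
    rw [← sub_smul, ← Algebra.smul_def, smul_smul, inv_mul_cancel₀ hc, one_smul]
  rw [h4, ← h2]
  exact h3.mul_left _

theorem exists_relInvariant_ne_zero [Finite G] (χ : G →* Fˣ) :
    ∃ f ∈ relInvariants G χ, f ≠ 0 := by
  obtain ⟨f, hf, hf0⟩ := exists_relInvariant_notMem ((act F V).comp G.subtype) ⊥ χ (by
    intro g hg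
    have : g = 1 := Subtype.ext (eq_one_of_forall_act_eq fun x =>
      sub_eq_zero.1 (Ideal.mem_bot.1 (hg (SymmetricAlgebra.ι F _ x))))
    rw [this, map_one])
  exact ⟨f, hf, hf0⟩

/-- For a character killing the pseudoreflections, no prime divides all relative invariants of
that weight. -/
theorem exists_relInvariant_not_dvd [Finite G] {χ : G →* Fˣ} (hχ : χ ∈ homZero G) {p : Poly F V}
    (hp : Prime p) : ∃ f ∈ relInvariants G χ, ¬ p ∣ f := by
  have : (Ideal.span {p}).IsPrime := (Ideal.span_singleton_prime hp.ne_zero).2 hp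
  obtain ⟨f, hf, hf0⟩ :=
    exists_relInvariant_notMem ((act F V).comp G.subtype) (Ideal.span {p}) χ (by
      intro g hg
      have hg' : ∀ a, p ∣ act F V g a - a := fun a => Ideal.mem_span_singleton.1 (hg a)
      rcases eq_or_ne g 1 with rfl | hg1
      · exact map_one _
      rcases isPseudoreflection_or_exists_ι (fun h => hg1 (Subtype.ext h)) hp hg' with
        h | ⟨q, hq, hgq, hq'⟩
      · exact hχ g h
      · obtain ⟨f, hf, hf0⟩ := exists_relInvariant_ne_zero χ
        exact eq_one_of_act_eq hq hgq hq' hf hf0)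
  exact ⟨f, hf, fun h => hf0 (Ideal.mem_span_singleton.2 h)⟩

end Reflections

/-! ### Orbit products and the factoriality of the monoid of relative invariants -/

section RelativeInvariants

universe u v

variable {F : Type u} [Field F] {V : Type v} [AddCommGroup V] [Module F V]
variable {G : Subgroup (LinearMap.GeneralLinearGroup F V)}

/-- A relative invariant representing an element of `D`. -/
noncomputable def rep (d : RedRel G) : Poly F V := (Quot.out d : relMonoid G)

theorem rep_ne_zero (d : RedRel G) : rep d ≠ 0 := (Quot.out d : relMonoid G).2.2

/-- The class of a representative, in the reduced monoid of polynomials. -/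
theorem redRelPoly_eq (d : RedRel G) :
    redRelPoly G d = Associates.mk (⟨rep d, rep_ne_zero d⟩ : polyMonoid F V) := by
  conv_lhs => rw [← Associates.quot_out d]
  rfl

theorem isDivisorHom_redRelPoly : IsDivisorHom (redRelPoly G) := isDivisorHom_embRelPoly.redMap

theorem redRelPoly_injective : Function.Injective (redRelPoly G) :=
  isDivisorHom_embRelPoly.redMap_injective

theorem redInvRel_injective : Function.Injective (redInvRel G) :=
  isDivisorHom_embInvRel.redMap_injective

theorem rep_dvd_rep {a b : RedRel G} : rep a ∣ rep b ↔ a ∣ b := by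
  have h : redRelPoly G a ∣ redRelPoly G b ↔ rep a ∣ rep b := by
    rw [redRelPoly_eq, redRelPoly_eq, Associates.mk_dvd_mk, polyMonoid_dvd_iff]
  rw [← h]
  exact ⟨isDivisorHom_redRelPoly a b, fun h => map_dvd _ h⟩

theorem rep_mk (a : relMonoid G) : Associated (rep (Associates.mk a)) (a : Poly F V) :=
  (Associates.mk_quot_out a).map (relMonoid G).subtype

theorem rep_mul (a b : RedRel G) : Associated (rep (a * b)) (rep a * rep b) := by
  have h := rep_mk (Quot.out a * Quot.out b : relMonoid G)
  rwa [← Associates.mk_mul_mk, Associates.quot_out, Associates.quot_out] at h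

theorem isUnit_rep_iff {d : RedRel G} : IsUnit (rep d) ↔ d = 1 := by
  have h1 : IsUnit (rep (1 : RedRel G)) := (rep_mk (1 : relMonoid G)).symm.isUnit isUnit_one
  refine ⟨fun h => ?_, fun h => h ▸ h1⟩
  exact associates_antisymm (rep_dvd_rep.1 h.dvd) (one_dvd d)

theorem rep_mem (d : RedRel G) : rep d ∈ relInvariants G (weight G d) := by
  have h := relWeight_spec G (Quot.out d)
  have h2 : weight G (Associates.mk (Quot.out d)) = relWeight G (Quot.out d) := rfl
  rw [Associates.quot_out] at h2
  rwa [← h2] at h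

theorem weight_mk_eq {f : relMonoid G} {χ : G →* Fˣ} (hf : (f : Poly F V) ∈ relInvariants G χ) :
    weight G (Associates.mk f) = χ :=
  weight_unique G f.2.2 (relWeight_spec G f) hf

theorem weight_eq_one_iff {d : RedRel G} : weight G d = 1 ↔ d ∈ Set.range (redInvRel G) := by
  constructor
  · intro h
    have h1 := rep_mem d
    rw [h] at h1
    refine ⟨Associates.mk ⟨rep d, mem_invariants_iff.2 h1, rep_ne_zero d⟩, ?_⟩
    conv_rhs => rw [← Associates.quot_out d]
    rfl
  · rintro ⟨h, rfl⟩
    obtain ⟨f, rfl⟩ := Associates.mk_surjective h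
    exact weight_mk_eq (f := embInvRel G f) (mem_invariants_iff.1 f.2.1)

/-- The action of `g` on the reduced monoid of polynomials. -/
noncomputable def actClass (g : LinearMap.GeneralLinearGroup F V) : RedPoly F V →* RedPoly F V :=
  redMap (actNonzero g)

theorem actClass_mul (g h : LinearMap.GeneralLinearGroup F V) (e : RedPoly F V) :
    actClass (g * h) e = actClass g (actClass h e) := by
  obtain ⟨f, rfl⟩ := Associates.mk_surjective e
  exact congrArg Associates.mk (Subtype.ext (act_mul g h f))

theorem actClass_one (e : RedPoly F V) : actClass 1 e = e := by
  obtain ⟨f, rfl⟩ := Associates.mk_surjective e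
  refine congrArg Associates.mk (Subtype.ext ?_)
  exact DFunLike.congr_fun (map_one (act F V)) (f : Poly F V)

theorem actClass_inv_actClass (g : LinearMap.GeneralLinearGroup F V) (e : RedPoly F V) :
    actClass g⁻¹ (actClass g e) = e := by
  rw [← actClass_mul, inv_mul_cancel, actClass_one]

theorem actClass_actClass_inv (g : LinearMap.GeneralLinearGroup F V) (e : RedPoly F V) :
    actClass g (actClass g⁻¹ e) = e := by
  rw [← actClass_mul, mul_inv_cancel, actClass_one]

theorem IsPrimeElement.actClass {e : RedPoly F V} (he : IsPrimeElement e)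
    (g : LinearMap.GeneralLinearGroup F V) : IsPrimeElement (actClass g e) := by
  have hdvd : ∀ x, InvariantDivisors.actClass g e ∣ x ↔
      e ∣ InvariantDivisors.actClass g⁻¹ x := fun x => by
    constructor
    · intro h
      have := map_dvd (InvariantDivisors.actClass g⁻¹) h
      rwa [actClass_inv_actClass] at this
    · intro h
      have := map_dvd (InvariantDivisors.actClass g) h
      rwa [actClass_actClass_inv] at this
  constructor
  · intro h
    have := h.map (InvariantDivisors.actClass g⁻¹)
    rw [actClass_inv_actClass] at this
    exact he.1 this
  · intro a b
    rw [hdvd, hdvd, hdvd, map_mul]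
    exact he.2 _ _

theorem isPrimeElement_mk {p : polyMonoid F V} (hp : Prime (p : Poly F V)) :
    IsPrimeElement (Associates.mk p) := by
  constructor
  · rw [Associates.isUnit_mk]
    exact fun h => hp.not_isUnit (h.map (polyMonoid F V).subtype)
  · intro a b
    obtain ⟨a, rfl⟩ := Associates.mk_surjective a
    obtain ⟨b, rfl⟩ := Associates.mk_surjective b
    rw [Associates.mk_mul_mk, Associates.mk_dvd_mk, Associates.mk_dvd_mk, Associates.mk_dvd_mk,
      polyMonoid_dvd_iff, polyMonoid_dvd_iff, polyMonoid_dvd_iff]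
    exact hp.dvd_or_dvd

theorem actClass_redRelPoly (g : G) (d : RedRel G) :
    actClass g.1 (redRelPoly G d) = redRelPoly G d := by
  rw [redRelPoly_eq]
  have h := rep_mem d g
  apply associates_antisymm <;> refine Associates.mk_dvd_mk.2 (polyMonoid_dvd_iff.2 ?_)
  · change act F V g (rep d) ∣ rep d
    rw [h]
    exact ⟨algebraMap F _ ((weight G d g)⁻¹ : Fˣ).val, by
      rw [mul_comm, ← Algebra.smul_def, smul_smul, Units.inv_mul, one_smul]⟩
  · change rep d ∣ act F V g (rep d)
    rw [h, Algebra.smul_def]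
    exact dvd_mul_left _ _

/-- The elements of `D`, inside the reduced monoid of polynomials, are the classes fixed by `G`:
if `g · f` is associated with `f` for all `g`, the occurring constants form a character. -/
theorem exists_redRelPoly_eq {e : RedPoly F V} (he : ∀ g : G, actClass g.1 e = e) :
    ∃ d, redRelPoly G d = e := by
  obtain ⟨f, rfl⟩ := Associates.mk_surjective e
  have h : ∀ g : G, ∃ c : Fˣ, act F V g f = (c : F) • (f : Poly F V) := by
    intro g
    obtain ⟨u, hu⟩ := Associates.mk_eq_mk_iff_associated.1 (he g)
    obtain ⟨c, hc⟩ := isUnit_poly_iff.1 (u.isUnit.map (polyMonoid F V).subtype)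
    have hu' : act F V g f * algebraMap F _ (c : F) = f := by
      rw [← hc]
      exact congrArg Subtype.val hu
    refine ⟨c⁻¹, ?_⟩
    conv_rhs => rw [← hu']
    rw [mul_comm, ← Algebra.smul_def, smul_smul, Units.inv_mul, one_smul]
  choose c hc using h
  have hinj : ∀ a b : Fˣ, (a : F) • (f : Poly F V) = (b : F) • (f : Poly F V) → a = b :=
    fun a b hab => Units.ext (smul_left_injective F f.2 hab)
  let χ : G →* Fˣ := MonoidHom.mk' c fun g h => hinj _ _ (by
    rw [← hc, Subgroup.coe_mul, act_mul, hc h, map_smul, hc g, smul_smul, Units.val_mul,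
      mul_comm])
  exact ⟨Associates.mk ⟨f, ⟨χ, hc⟩, f.2⟩, rfl⟩

theorem finite_orbit [Finite G] (e : RedPoly F V) : (orbit G e).Finite := by
  refine (Set.finite_range fun g : G => actClass g.1 e).subset ?_
  rintro _ ⟨g, hg, rfl⟩
  exact ⟨⟨g, hg⟩, rfl⟩

/-- The orbit product of a prime `p` belongs to `D`, and it divides exactly those relative
invariants that are divisible by `p`. -/
theorem exists_orbitProduct [Finite G] {p : polyMonoid F V} (hp : Prime (p : Poly F V)) :
    ∃ q : RedRel G, redRelPoly G q = ∏ᶠ r ∈ orbit G (Associates.mk p), r ∧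
      ∀ d, q ∣ d ↔ (p : Poly F V) ∣ rep d := by
  classical
  set e := Associates.mk p with he
  have hfin := finite_orbit (G := G) e
  have hprod : ∏ᶠ r ∈ orbit G e, r = ∏ r ∈ hfin.toFinset, r :=
    finprod_mem_eq_finite_toFinset_prod _ hfin
  have hmem : ∀ {r}, r ∈ hfin.toFinset ↔ ∃ g ∈ G, r = actClass g e := by
    intro r
    rw [Set.Finite.mem_toFinset]
    rfl
  have hmaps : ∀ g ∈ G, ∀ r ∈ hfin.toFinset, actClass g r ∈ hfin.toFinset := by
    intro g hg r hr
    obtain ⟨h, hh, rfl⟩ := hmem.1 hr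
    exact hmem.2 ⟨g * h, mul_mem hg hh, (actClass_mul g h e).symm⟩
  have hfixed : ∀ g : G, actClass g.1 (∏ᶠ r ∈ orbit G e, r) = ∏ᶠ r ∈ orbit G e, r := by
    rintro ⟨g, hg⟩
    rw [hprod, map_prod]
    exact Finset.prod_nbij' (fun r => actClass g r) (fun r => actClass g⁻¹ r) (hmaps g hg)
      (hmaps g⁻¹ (inv_mem hg)) (fun r _ => actClass_inv_actClass g r)
      (fun r _ => actClass_actClass_inv g r) (fun _ _ => rfl)
  obtain ⟨q, hq⟩ := exists_redRelPoly_eq hfixed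
  have hprime : ∀ r ∈ hfin.toFinset, IsPrimeElement r := by
    intro r hr
    obtain ⟨g, -, rfl⟩ := hmem.1 hr
    exact (isPrimeElement_mk hp).actClass g
  have hdvd : ∀ d : RedRel G, e ∣ redRelPoly G d ↔ (p : Poly F V) ∣ rep d := fun d => by
    rw [redRelPoly_eq, he, Associates.mk_dvd_mk, polyMonoid_dvd_iff]
  refine ⟨q, hq, fun d => ?_⟩
  rw [← hdvd]
  constructor
  · intro h
    refine dvd_trans ?_ (map_dvd (redRelPoly G) h)
    rw [hq, hprod]
    exact Finset.dvd_prod_of_mem _ (hmem.2 ⟨1, one_mem _, (actClass_one e).symm⟩)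
  · intro h
    apply isDivisorHom_redRelPoly
    rw [hq, hprod]
    refine prod_dvd_of_isPrimeElement _ hprime
      (fun a ha b hb hab => (hprime a ha).eq_of_dvd (hprime b hb) hab) fun r hr => ?_
    obtain ⟨g, hg, rfl⟩ := hmem.1 hr
    rw [← actClass_redRelPoly ⟨g, hg⟩ d]
    exact map_dvd _ h

theorem isPrimeElement_of_dvd_iff {p : Poly F V} (hp : Prime p) {q : RedRel G}
    (hq : ∀ d, q ∣ d ↔ p ∣ rep d) : IsPrimeElement q := by
  constructor
  · intro h
    have h1 := (hq 1).1 h.dvd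
    exact hp.not_isUnit (isUnit_of_dvd_unit h1 (isUnit_rep_iff.2 rfl))
  · intro a b
    rw [hq, hq, hq, (rep_mul a b).dvd_iff_dvd_right]
    exact hp.dvd_or_dvd

theorem exists_isPrimeElement_dvd_iff [Finite G] {p : Poly F V} (hp : Prime p) :
    ∃ q : RedRel G, IsPrimeElement q ∧ ∀ d, q ∣ d ↔ p ∣ rep d := by
  obtain ⟨q, -, hq⟩ := exists_orbitProduct (G := G) (p := ⟨p, hp.ne_zero⟩) hp
  exact ⟨q, isPrimeElement_of_dvd_iff hp hq, hq⟩

theorem exists_prime_dvd_rep {d : RedRel G} (hd : d ≠ 1) : ∃ p, Prime p ∧ p ∣ rep d := by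
  obtain ⟨p, hp, hpd⟩ := WfDvdMonoid.exists_irreducible_factor
    (fun h => hd (isUnit_rep_iff.1 h)) (rep_ne_zero d)
  exact ⟨p, hp.prime, hpd⟩

theorem isPrimeElement_iff_mem_orbitProducts [Finite G] {q : RedRel G} :
    IsPrimeElement q ↔ redRelPoly G q ∈ orbitProducts G := by
  constructor
  · intro h
    obtain ⟨p, hp, hpq⟩ := exists_prime_dvd_rep (d := q) (fun h1 => h.1 (h1 ▸ isUnit_one))
    obtain ⟨q', hq', hdvd⟩ := exists_orbitProduct (G := G) (p := ⟨p, hp.ne_zero⟩) hp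
    rw [← (isPrimeElement_of_dvd_iff hp hdvd).eq_of_dvd h ((hdvd q).2 hpq)]
    exact ⟨_, ⟨_, hp.irreducible, rfl⟩, hq'⟩
  · rintro ⟨_, ⟨p, hp, rfl⟩, hq⟩
    obtain ⟨q', hq', hdvd⟩ := exists_orbitProduct (G := G) hp.prime
    rw [redRelPoly_injective (hq.trans hq'.symm)]
    exact isPrimeElement_of_dvd_iff hp.prime hdvd

theorem finiteMultiplicity_of_ne_one {q d : RedRel G} (hq : q ≠ 1) : FiniteMultiplicity q d := by
  obtain ⟨n, hn⟩ := FiniteMultiplicity.of_not_isUnit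
    (fun h => hq (isUnit_rep_iff.1 h)) (rep_ne_zero d)
  refine ⟨n, fun h => hn ?_⟩
  have hpow : ∀ k : ℕ, Associated (rep (q ^ k)) (rep q ^ k) := by
    intro k
    induction k with
    | zero => rw [pow_zero, pow_zero, associated_one_iff_isUnit]; exact isUnit_rep_iff.2 rfl
    | succ k ih =>
      rw [pow_succ, pow_succ]
      exact (rep_mul _ _).trans (ih.mul_right _)
  rw [← (hpow _).dvd_iff_dvd_left]
  exact rep_dvd_rep.2 h

/-- Induction along proper divisors in `D`. -/
theorem relInduction {P : RedRel G → Prop}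
    (h : ∀ d, (∀ c a, c ≠ 1 → d = c * a → P a) → P d) (d : RedRel G) : P d := by
  have key : ∀ f : Poly F V, ∀ d : RedRel G, rep d = f → P d := by
    intro f
    induction f using (wellFounded_dvdNotUnit (α := Poly F V)).induction with
    | _ f ih =>
      rintro d rfl
      refine h d fun c a hc hd => ih (rep a) ?_ a rfl
      refine dvdNotUnit_of_dvd_of_not_dvd (rep_dvd_rep.2 (hd ▸ dvd_mul_left a c)) fun h1 => ?_
      obtain ⟨b, hb⟩ := rep_dvd_rep.1 h1
      apply hc
      rw [← Associates.isUnit_iff_eq_one]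
      refine isUnit_of_dvd_one ⟨b, Eq.symm (mul_left_cancel (a := a) ?_)⟩
      rw [mul_one, ← mul_assoc, mul_comm a c, ← hd, ← hb]
  exact key _ d rfl

theorem isFactorialMonoid_redRel [Finite G] : IsFactorialMonoid (RedRel G) := by
  intro d
  induction d using relInduction with
  | h d ih =>
    intro hd
    rw [Associates.isUnit_iff_eq_one] at hd
    obtain ⟨p, hp, hpd⟩ := exists_prime_dvd_rep hd
    obtain ⟨q, hq, hqd⟩ := exists_isPrimeElement_dvd_iff (G := G) hp
    obtain ⟨a, rfl⟩ := (hqd d).2 hpd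
    by_cases ha : IsUnit a
    · refine ⟨{q}, by simpa using hq, ?_⟩
      rw [(Associates.isUnit_iff_eq_one a).1 ha, mul_one, Multiset.prod_singleton]
    · obtain ⟨s, hs, rfl⟩ := ih q a (fun h => hq.1 (h ▸ isUnit_one)) rfl ha
      refine ⟨q ::ₘ s, fun r hr => ?_, Multiset.prod_cons _ _⟩
      rcases Multiset.mem_cons.1 hr with rfl | hr
      exacts [hq, hs r hr]

end RelativeInvariants

/-! ### Greatest common divisors of invariants -/

/-- If no prime divides all elements of `S`, a common divisor of the multiples `d * s` divides
`d`. -/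
theorem dvd_of_forall_dvd_mul {R : Type*} [CommMonoidWithZero R] [UniqueFactorizationMonoid R]
    {S : Set R} (hS : ∀ p, Prime p → ∃ s ∈ S, ¬ p ∣ s) {c d : R} (hc : c ≠ 0)
    (h : ∀ s ∈ S, c ∣ d * s) : c ∣ d := by
  induction c using UniqueFactorizationMonoid.induction_on_prime generalizing d with
  | h₁ => exact absurd rfl hc
  | h₂ x hx => exact hx.dvd
  | h₃ a p ha hp ih =>
    obtain ⟨s, hs, hps⟩ := hS p hp
    obtain ⟨d, rfl⟩ := (hp.dvd_or_dvd ((dvd_mul_right p a).trans (h s hs))).resolve_right hps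
    refine mul_dvd_mul_left p (ih ha fun t ht => ?_)
    have := h t ht
    rw [mul_assoc] at this
    exact (mul_dvd_mul_iff_left hp.ne_zero).1 this

section GcdMonoid

universe u v

variable {F : Type u} [Field F] {V : Type v} [AddCommGroup V] [Module F V]
variable {G : Subgroup (LinearMap.GeneralLinearGroup F V)}

theorem IsPrimeElement.ne_one {q : RedRel G} (hq : IsPrimeElement q) : q ≠ 1 :=
  fun h => hq.1 (h ▸ isUnit_one)

/-- If `d` is the greatest common divisor of invariants, a given `q ≠ 1` fails to divide one of
the cofactors. -/
theorem exists_eq_mul_not_dvd {d q : RedRel G} (hd : d ∈ gcdSet G) (hq : q ≠ 1) :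
    ∃ (h : RedInv G) (y : RedRel G), redInvRel G h = d * y ∧ ¬ q ∣ y := by
  obtain ⟨X, -, -, hX⟩ := hd
  by_contra! hcon
  have h1 : d * q ∣ d := by
    refine hX.2 _ ?_
    rintro _ ⟨h, hh, rfl⟩
    obtain ⟨y, hy⟩ := hX.1 _ ⟨h, hh, rfl⟩
    rw [hy]
    exact mul_dvd_mul_left d (hcon h y hy)
  obtain ⟨k, hk⟩ := h1
  refine hq ((Associates.isUnit_iff_eq_one q).1 (isUnit_of_dvd_one ⟨k, ?_⟩))
  apply mul_left_cancel (a := d)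
  rw [mul_one, ← mul_assoc, ← hk]

theorem weight_redInvRel (h : RedInv G) : weight G (redInvRel G h) = 1 :=
  weight_eq_one_iff.2 ⟨h, rfl⟩

theorem weight_apply_eq_one_of_not_dvd {g : G} {p : Poly F V} (h : ∀ a, p ∣ act F V g a - a)
    {d : RedRel G} (hd : ¬ p ∣ rep d) : weight G d g = 1 :=
  eq_one_of_not_dvd h (rep_mem d) hd

theorem weight_mem_homZero_of_mem_gcdSet [Finite G] {d : RedRel G} (hd : d ∈ gcdSet G) :
    weight G d ∈ homZero G := by
  intro g hg
  obtain ⟨p, hp, hpg⟩ := hg.exists_ι_dvd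
  obtain ⟨q, hq, hqd⟩ := exists_isPrimeElement_dvd_iff (G := G) hp
  obtain ⟨h, y, hy, hqy⟩ := exists_eq_mul_not_dvd hd hq.ne_one
  have h1 := weight_redInvRel h
  rw [hy, map_mul] at h1
  have h2 := DFunLike.congr_fun h1 g
  rwa [MonoidHom.mul_apply, weight_apply_eq_one_of_not_dvd hpg (fun h => hqy ((hqd y).2 h)),
    mul_one] at h2

/-- Every class of relative invariants of a weight killing the pseudoreflections is a greatest
common divisor of invariants: multiplying it by relative invariants of the inverse weight, no
prime dividing all of these, gives the required invariants. Finitely many of them suffice, as any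
one of them has only finitely many prime divisors. -/
theorem mem_gcdSet_of_weight_mem_homZero [Finite G] {d : RedRel G} (hd : weight G d ∈ homZero G) :
    d ∈ gcdSet G := by
  classical
  have hex : ∀ f ∈ relInvariants G (weight G d)⁻¹, f ≠ 0 → ∃ y : RedRel G,
      weight G y = (weight G d)⁻¹ ∧ Associated (rep y) f := fun f hf hf0 =>
    ⟨Associates.mk ⟨f, ⟨_, hf⟩, hf0⟩, weight_mk_eq (f := ⟨f, ⟨_, hf⟩, hf0⟩) hf, rep_mk _⟩
  obtain ⟨y₀, hy₀, -⟩ : ∃ y : RedRel G, weight G y = (weight G d)⁻¹ ∧ True := by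
    obtain ⟨f, hf, hf0⟩ := exists_relInvariant_ne_zero (weight G d)⁻¹
    obtain ⟨y, hy, -⟩ := hex f hf hf0
    exact ⟨y, hy, trivial⟩
  have hp : ∀ p : Poly F V, ∃ y : RedRel G, weight G y = (weight G d)⁻¹ ∧
      (Prime p → ¬ p ∣ rep y) := by
    intro p
    by_cases hp : Prime p
    · obtain ⟨f, hf, hpf⟩ := exists_relInvariant_not_dvd (inv_mem hd) hp
      obtain ⟨y, hy, hyf⟩ := hex f hf (fun h => hpf (h ▸ dvd_zero p))
      exact ⟨y, hy, fun _ h => hpf (hyf.dvd_iff_dvd_right.1 h)⟩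
    · exact ⟨y₀, hy₀, fun h => absurd h hp⟩
  choose y hyw hyp using hp
  -- a prime dividing `y₀` is associated with one of its factors `p`, and `y p` avoids it
  let Y : Finset (RedRel G) :=
    insert y₀ ((UniqueFactorizationMonoid.factors (rep y₀)).toFinset.image y)
  have hYw : ∀ z ∈ Y, weight G z = (weight G d)⁻¹ := by
    intro z hz
    rcases Finset.mem_insert.1 hz with rfl | hz
    · exact hy₀
    · obtain ⟨p, -, rfl⟩ := Finset.mem_image.1 hz
      exact hyw p
  have hYp : ∀ p, Prime p → ∃ z ∈ Y, ¬ p ∣ rep z := by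
    intro p hp
    by_cases h0 : p ∣ rep y₀
    · obtain ⟨p', hp', hpp'⟩ :=
        UniqueFactorizationMonoid.exists_mem_factors_of_dvd (rep_ne_zero y₀) hp.irreducible h0
      exact ⟨y p', Finset.mem_insert_of_mem (Finset.mem_image_of_mem y (by simpa using hp')),
        fun h => hyp p' (hpp'.prime hp) (hpp'.symm.dvd.trans h)⟩
    · exact ⟨y₀, Finset.mem_insert_self _ _, h0⟩
  have himage : redInvRel G '' (redInvRel G ⁻¹' ((d * ·) '' (Y : Set (RedRel G)))) =
      (d * ·) '' (Y : Set (RedRel G)) := by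
    apply Set.image_preimage_eq_of_subset
    rintro _ ⟨z, hz, rfl⟩
    apply weight_eq_one_iff.1
    rw [map_mul, hYw z hz]
    ext g
    simp
  refine ⟨redInvRel G ⁻¹' ((d * ·) '' (Y : Set (RedRel G))),
    (Y.finite_toSet.image _).preimage redInvRel_injective.injOn, ?_, ?_⟩
  · apply Set.Nonempty.of_image (f := redInvRel G)
    rw [himage]
    exact ⟨_, y₀, Finset.mem_insert_self _ _, rfl⟩
  · rw [himage]
    constructor
    · rintro _ ⟨z, -, rfl⟩
      exact dvd_mul_right d z
    · intro c hc
      rw [← rep_dvd_rep]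
      refine dvd_of_forall_dvd_mul (S := rep '' (Y : Set (RedRel G))) ?_ (rep_ne_zero c) ?_
      · intro p hp
        obtain ⟨z, hz, hpz⟩ := hYp p hp
        exact ⟨_, ⟨z, hz, rfl⟩, hpz⟩
      · rintro _ ⟨z, hz, rfl⟩
        exact (rep_mul d z).dvd_iff_dvd_right.1 (rep_dvd_rep.2 (hc _ ⟨z, hz, rfl⟩))

theorem mem_gcdSet_iff [Finite G] {d : RedRel G} : d ∈ gcdSet G ↔ weight G d ∈ homZero G :=
  ⟨weight_mem_homZero_of_mem_gcdSet, mem_gcdSet_of_weight_mem_homZero⟩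

theorem mem_gcdMonoid_iff [Finite G] {d : RedRel G} :
    d ∈ gcdMonoid G ↔ weight G d ∈ homZero G := by
  have h : gcdMonoid G ≤ (homZero G).toSubmonoid.comap (weight G) :=
    Submonoid.closure_le.2 fun _ => weight_mem_homZero_of_mem_gcdSet
  exact ⟨fun hd => h hd, fun hd => Submonoid.subset_closure (mem_gcdSet_iff.2 hd)⟩

theorem mem_gcdMonoid_iff_mem_gcdSet [Finite G] {d : RedRel G} :
    d ∈ gcdMonoid G ↔ d ∈ gcdSet G :=
  mem_gcdMonoid_iff.trans mem_gcdSet_iff.symm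

theorem mem_gcdMonoid_of_mul [Finite G] {a b : RedRel G} (ha : a ∈ gcdMonoid G)
    (hab : a * b ∈ gcdMonoid G) : b ∈ gcdMonoid G := by
  rw [mem_gcdMonoid_iff] at ha hab ⊢
  rw [map_mul] at hab
  exact ((homZero G).mul_mem_cancel_left ha).1 hab

/-- Divisibility between greatest common divisors of invariants means the same in `D₀` as
in `D`. -/
theorem gcdMonoid_dvd_iff [Finite G] {a b : gcdMonoid G} : a ∣ b ↔ (a : RedRel G) ∣ b := by
  constructor
  · exact fun h => map_dvd (gcdMonoid G).subtype h
  · rintro ⟨c, hc⟩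
    exact ⟨⟨c, mem_gcdMonoid_of_mul a.2 (hc ▸ b.2)⟩, Subtype.ext hc⟩

/-! ### The basis of the monoid of greatest common divisors -/

theorem pow_card_mem_range_redInvRel [Finite G] (d : RedRel G) :
    d ^ Nat.card G ∈ Set.range (redInvRel G) := by
  rw [← weight_eq_one_iff, map_pow, pow_card_eq_one]

theorem emultiplicity_pow_mul {q u : RedRel G} (hu : ¬ q ∣ u) (k : ℕ) :
    emultiplicity q (q ^ k * u) = k := by
  rw [emultiplicity_eq_coe]
  refine ⟨dvd_mul_right _ _, fun h => hu ?_⟩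
  obtain ⟨v, hv⟩ := h
  exact ⟨v, mul_left_cancel (a := q ^ k) (by rw [hv, pow_succ, mul_assoc])⟩

theorem ramIndex_le {q u : RedRel G} {h : RedInv G} {k : ℕ} (hk : k ≠ 0)
    (hh : redInvRel G h = q ^ k * u) (hu : ¬ q ∣ u) : ramIndex G q ≤ k :=
  Nat.sInf_le ⟨h, hh ▸ (dvd_pow_self q hk).mul_right u, hh ▸ emultiplicity_pow_mul hu k⟩

theorem ramIndex_spec [Finite G] {q : RedRel G} (hq : q ≠ 1) :
    ramIndex G q ≠ 0 ∧ ∃ (h : RedInv G) (u : RedRel G),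
      redInvRel G h = q ^ ramIndex G q * u ∧ ¬ q ∣ u := by
  have hne : {k : ℕ | ∃ h : RedInv G, q ∣ redInvRel G h ∧
      emultiplicity q (redInvRel G h) = k}.Nonempty := by
    obtain ⟨h, hh⟩ := pow_card_mem_range_redInvRel q
    refine ⟨Nat.card G, h, hh ▸ dvd_pow_self q Nat.card_pos.ne', ?_⟩
    rw [hh, ← mul_one (q ^ Nat.card G)]
    exact emultiplicity_pow_mul
      (fun h => hq ((Associates.isUnit_iff_eq_one q).1 (isUnit_of_dvd_one h))) _
  obtain ⟨h, hqh, hk⟩ := Nat.sInf_mem hne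
  obtain ⟨⟨u, hu⟩, hn⟩ := emultiplicity_eq_coe.1 hk
  refine ⟨fun h0 => hn ?_, h, u, hu, ?_⟩
  · change sInf _ = 0 at h0
    rwa [h0, zero_add, pow_one]
  · rintro ⟨w, rfl⟩
    exact hn ⟨w, by rw [hu, pow_succ, mul_assoc]⟩

theorem IsPrimeElement.dvd_pow_ramIndex [Finite G] {q : RedRel G} (hq : IsPrimeElement q) :
    q ∣ q ^ ramIndex G q :=
  dvd_pow_self q (ramIndex_spec hq.ne_one).1

/-- Let `p` be the linear form of the hyperplane of a pseudoreflection `g`. If `p` does not divide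
`q`, the weight of every power of `q` is trivial on `g`. Otherwise `p` does not divide the cofactor
of `q ^ e(q)` in a suitable invariant, so the weight of this cofactor is trivial on `g`. -/
theorem pow_ramIndex_mem_gcdMonoid [Finite G] {q : RedRel G} (hq : IsPrimeElement q) :
    q ^ ramIndex G q ∈ gcdMonoid G := by
  rw [mem_gcdMonoid_iff]
  intro g hg
  obtain ⟨p, hp, hpg⟩ := hg.exists_ι_dvd
  obtain ⟨r, hr, hrd⟩ := exists_isPrimeElement_dvd_iff (G := G) hp
  obtain ⟨-, h, u, hu, hqu⟩ := ramIndex_spec hq.ne_one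
  by_cases hrq : r = q
  · subst hrq
    have h1 := weight_redInvRel h
    rw [hu, map_mul] at h1
    have h2 := DFunLike.congr_fun h1 g
    rwa [MonoidHom.mul_apply,
      weight_apply_eq_one_of_not_dvd hpg (fun h => hqu ((hrd u).2 h)), mul_one] at h2
  · refine weight_apply_eq_one_of_not_dvd hpg fun h => hrq ?_
    exact hr.eq_of_dvd hq (hr.dvd_of_dvd_pow ((hrd _).2 h))

theorem injOn_pow_ramIndex [Finite G] :
    Set.InjOn (fun q : RedRel G => q ^ ramIndex G q) {q | IsPrimeElement q} := by
  intro q hq r hr h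
  have h1 := IsPrimeElement.dvd_pow_ramIndex hq
  rw [show q ^ ramIndex G q = r ^ ramIndex G r from h] at h1
  exact IsPrimeElement.eq_of_dvd hq hr (IsPrimeElement.dvd_of_dvd_pow hq h1)

theorem isFreeAbelianWithBasis_gcdMonoid [Finite G] : IsFreeAbelianWithBasis (gcdMonoid G)
    ((fun q : RedRel G => q ^ ramIndex G q) '' {q | IsPrimeElement q}) := by
  refine ⟨injective_finsuppProd_of_isPrimeElement ?_, Set.Subset.antisymm ?_ ?_⟩
  · rintro _ ⟨q, hq, rfl⟩
    refine ⟨q, hq, IsPrimeElement.dvd_pow_ramIndex hq, ?_⟩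
    rintro _ ⟨r, hr, rfl⟩ hqr
    dsimp only at hqr ⊢
    rw [IsPrimeElement.eq_of_dvd hq hr (IsPrimeElement.dvd_of_dvd_pow hq hqr)]
  · rintro _ ⟨n, rfl⟩
    refine (gcdMonoid G).prod_mem ?_
    rintro ⟨_, q, hq, rfl⟩ -
    exact pow_mem (pow_ramIndex_mem_gcdMonoid hq) _
  · intro d
    induction d using relInduction with
    | h d ih =>
      intro hd
      by_cases hd1 : d = 1
      · exact ⟨0, hd1 ▸ Finsupp.prod_zero_index⟩
      obtain ⟨p, hp, hpd⟩ := exists_prime_dvd_rep hd1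
      obtain ⟨q, hq, hqd⟩ := exists_isPrimeElement_dvd_iff (G := G) hp
      obtain ⟨c, hc, hqc⟩ :=
        (finiteMultiplicity_of_ne_one (d := d) hq.ne_one).exists_eq_pow_mul_and_not_dvd
      obtain ⟨h, y, hy, hqy⟩ := exists_eq_mul_not_dvd (mem_gcdMonoid_iff_mem_gcdSet.1 hd) hq.ne_one
      -- `d` has a multiple in `H` in which `q` has the same exponent, so that `e(q)` is at most the
      -- exponent of `q` in `d`
      have hk : multiplicity q d ≠ 0 := fun h0 => by
        rw [h0, pow_zero, one_mul] at hc
        exact hqc (hc ▸ (hqd d).2 hpd)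
      rw [hc, mul_assoc] at hy
      have hle := ramIndex_le hk hy (fun h => (hq.2 _ _ h).elim hqc hqy)
      obtain ⟨a, ha⟩ : q ^ ramIndex G q ∣ d := by
        rw [hc]
        exact (pow_dvd_pow q hle).mul_right c
      have hne : q ^ ramIndex G q ≠ 1 := fun h1 =>
        hq.1 (isUnit_of_dvd_one (h1 ▸ hq.dvd_pow_ramIndex))
      obtain ⟨n, hn⟩ := ih _ a hne ha
        (mem_gcdMonoid_of_mul (pow_ramIndex_mem_gcdMonoid hq) (ha ▸ hd))
      refine ⟨Finsupp.single ⟨_, q, hq, rfl⟩ 1 + n, ?_⟩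
      dsimp only at hn ⊢
      rw [finsuppProd_single_add, hn, ha]

theorem isDivisorTheory_redInvGcd [Finite G] : IsDivisorTheory (redInvGcd G) := by
  refine ⟨fun a b h => isDivisorHom_embInvRel.redMap a b (gcdMonoid_dvd_iff.1 h), _,
    isFreeAbelianWithBasis_gcdMonoid.subtype ?_, ?_⟩
  · rintro _ ⟨q, hq, rfl⟩
    exact pow_ramIndex_mem_gcdMonoid hq
  · rintro d -
    obtain ⟨X, hX, hne, hgcd⟩ := mem_gcdMonoid_iff_mem_gcdSet.1 d.2
    refine ⟨X, hX, hne, ?_, fun c hc => ?_⟩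
    · rintro _ ⟨h, hh, rfl⟩
      exact gcdMonoid_dvd_iff.2 (hgcd.1 _ ⟨h, hh, rfl⟩)
    · refine gcdMonoid_dvd_iff.2 (hgcd.2 _ ?_)
      rintro _ ⟨h, hh, rfl⟩
      exact gcdMonoid_dvd_iff.1 (hc _ ⟨h, hh, rfl⟩)

/-! ### The class group -/

/-- The weight as a homomorphism from `D₀` to the characters killing the pseudoreflections. -/
noncomputable def gcdWeight (G : Subgroup (LinearMap.GeneralLinearGroup F V)) [Finite G] :
    gcdMonoid G →* homZero G where
  toFun d := ⟨weight G d, mem_gcdMonoid_iff.1 d.2⟩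
  map_one' := Subtype.ext (map_one _)
  map_mul' _ _ := Subtype.ext (map_mul _ _ _)

theorem gcdWeight_eq_one_iff [Finite G] {d : gcdMonoid G} :
    gcdWeight G d = 1 ↔ d ∈ Set.range (redInvGcd G) := by
  rw [Subtype.ext_iff]
  refine weight_eq_one_iff.trans ⟨?_, ?_⟩
  · rintro ⟨h, hh⟩
    exact ⟨h, Subtype.ext hh⟩
  · rintro ⟨h, rfl⟩
    exact ⟨h, rfl⟩

theorem gcdWeight_surjective [Finite G] : Function.Surjective (gcdWeight G) := by
  rintro ⟨χ, hχ⟩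
  obtain ⟨f, hf, hf0⟩ := exists_relInvariant_ne_zero χ
  have h := weight_mk_eq (f := ⟨f, ⟨χ, hf⟩, hf0⟩) hf
  exact ⟨⟨_, mem_gcdMonoid_iff.2 (h.symm ▸ hχ)⟩, Subtype.ext h⟩

theorem isCofinalHom_redInvGcd [Finite G] : IsCofinalHom (redInvGcd G) := by
  intro d
  obtain ⟨h, hh⟩ := isCofinalHom_embInvRel.redMap (d : RedRel G)
  exact ⟨h, gcdMonoid_dvd_iff.2 hh⟩

/-- The class group of any divisor theory of `H` is isomorphic to `Hom⁰(G, Fˣ)`, as divisor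
theories are unique. -/
theorem IsDivisorTheory.nonempty_homClassGroup_equiv [Finite G] {T : Type*} [CommMonoid T]
    {θ : RedInv G →* T} (hθ : IsDivisorTheory θ) : Nonempty (HomClassGroup θ ≃* homZero G) := by
  obtain ⟨e, he⟩ := hθ.exists_equiv isDivisorTheory_redInvGcd
  obtain ⟨ε, -⟩ := exists_homClassGroup_equiv (f := θ) (w := (gcdWeight G).comp e.toMonoidHom)
    (fun t => by
      obtain ⟨h, hh⟩ := isCofinalHom_redInvGcd (e t)
      rw [← he] at hh
      exact ⟨h, (map_dvd_iff e).1 hh⟩)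
    (fun t => by
      refine gcdWeight_eq_one_iff.trans (exists_congr fun h => ?_)
      rw [← he]
      exact e.injective.eq_iff)
    (gcdWeight_surjective.comp e.surjective)
  exact ⟨ε⟩

end GcdMonoid

end InvariantDivisors

theorem mainTheorem1 {F : Type*} [Field F] {V : Type*} [AddCommGroup V] [Module F V]
    [FiniteDimensional F V] (G : Subgroup (LinearMap.GeneralLinearGroup F V)) [Finite G] :
    -- the embeddings are cofinal divisor homomorphisms
    ((IsDivisorHom (embInvRel G) ∧
        IsCofinalHom (embInvRel G)) ∧
      (IsDivisorHom (embRelPoly G) ∧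
        IsCofinalHom (embRelPoly G))) ∧
    -- `H ⊆ D ⊆ E`, the monoid `D` is factorial, its primes are the orbit products, and the
    -- class group of the first embedding is torsion
    (Function.Injective (redInvRel G) ∧
      Function.Injective (redRelPoly G) ∧
      IsFactorialMonoid (RedRel G) ∧
      redRelPoly G ''
          {q : RedRel G | IsPrimeElement q} =
        orbitProducts G ∧
      IsMulTorsion (HomClassGroup (embInvRel G))) ∧
    -- the gcds form a monoid `D₀`, free abelian on the `q ^ e(q)`, and `H → D₀` is a
    -- divisor theory
    ((gcdMonoid G : Set (RedRel G)) =
        gcdSet G ∧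
      Set.InjOn (fun q : RedRel G => q ^ ramIndex G q)
        {q | redRelPoly G q ∈ orbitProducts G} ∧
      IsFreeAbelianWithBasis (gcdMonoid G)
        ((fun q : RedRel G => q ^ ramIndex G q) ''
          {q | redRelPoly G q ∈ orbitProducts G}) ∧
      IsDivisorTheory (redInvGcd G)) ∧
    -- `D₀` is cut out by the weight condition, and the weight map induces an isomorphism
    -- of the class group of `H → D₀` with `Hom⁰(G, Fˣ)`
    ((gcdMonoid G : Set (RedRel G)) =
        {d | weight G d ∈ homZero G} ∧
      ∃ e : HomClassGroup (redInvGcd G) ≃*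
          homZero G,
        ∀ d : gcdMonoid G,
          (e (homClass (redInvGcd G) d) : G →* Fˣ) =
            weight G (d : RedRel G)) ∧
    -- the class group of the ring of invariants, computed by any divisor theory of `H`,
    -- is isomorphic to `Hom⁰(G, Fˣ)`
    (∀ (T : Type*) [CommMonoid T] (θ : RedInv G →* T),
      IsDivisorTheory θ →
        Nonempty (HomClassGroup θ ≃* homZero G)) := by
  have hset : {q | redRelPoly G q ∈ orbitProducts G} = {q | IsPrimeElement q} :=
    Set.ext fun q => isPrimeElement_iff_mem_orbitProducts.symm
  refine ⟨⟨⟨isDivisorHom_embInvRel, isCofinalHom_embInvRel⟩, isDivisorHom_embRelPoly,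
    isCofinalHom_embRelPoly⟩, ⟨redInvRel_injective, redRelPoly_injective,
    isFactorialMonoid_redRel, ?_, ?_⟩, ⟨?_, ?_, ?_, ?_⟩, ⟨?_, ?_⟩, ?_⟩
  · rw [← hset]
    refine Set.image_preimage_eq_of_subset ?_
    rintro _ ⟨_, ⟨p, hp, rfl⟩, rfl⟩
    obtain ⟨q, hq, -⟩ := exists_orbitProduct (G := G) hp.prime
    exact ⟨q, hq⟩
  · exact isMulTorsion_homClassGroup Nat.card_pos pow_card_mem_range_embInvRel
  · exact Set.ext fun d => mem_gcdMonoid_iff_mem_gcdSet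
  · rw [hset]
    exact injOn_pow_ramIndex
  · rw [hset]
    exact isFreeAbelianWithBasis_gcdMonoid
  · exact isDivisorTheory_redInvGcd
  · exact Set.ext fun d => mem_gcdMonoid_iff
  · obtain ⟨e, he⟩ := exists_homClassGroup_equiv isCofinalHom_redInvGcd
      (fun d => gcdWeight_eq_one_iff) (gcdWeight_surjective (G := G))
    exact ⟨e, fun d => congrArg Subtype.val (he d)⟩
  · intro T _ θ hθ
    exact hθ.nonempty_homClassGroup_equiv
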